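/- Let $m=(m_0,m_1,\dots)$ be a bounded sequence of integers $m_k\ge 2$, let $G_m=\prod_{k}\mathbb{Z}/m_k\mathbb{Z}$ with its normalized Haar measure $\mu$ (the product of the uniform measures), and put $M_0=1$, $M_{k+1}=m_kM_k$. Every $n\in\mathbb{N}$ is uniquely $n=\sum_k n_kM_k$ with $0\le n_k<m_k$; let $\psi_n(x)=\prod_k \exp(2\pi i\,n_kx_k/m_k)$ be the Vilenkin functions. Let $\mathcal F_n$ be the $\sigma$-algebra generated by the sets $I_n(x)=\{y: y_0=x_0,\dots,y_{n-1}=x_{n-1}\}$. For $0<p<\infty$ the Hardy space $H_p$ consists of all complex martingales $f=(f^{(n)})_{n\in\mathbb{N}}$ with respect to $(\mathcal F_n)$ such that $\|f\|_{H_p}:=\|\sup_n|f^{(n)}|\|_p<\infty$, where $\|g\|_p=(\int|g|^p\,d\mu)^{1/p}$. For such $f$ put $\widehat f(i)=\lim_{k\to\infty}\int f^{(k)}\overline{\psi_i}\,d\mu$, $S_nf=\sum_{i=0}^{n-1}\widehat f(i)\psi_i$, $\sigma_nf=\frac1n\sum_{k=1}^nS_kf$, and $\omega(1/M_N,f)_{H_p}=\|f-S_{M_N}f\|_{H_p}$,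 where $f-S_{M_N}f$ is the martingale $(f^{(k)}-S_{M_N}f^{(k)})_k$, with $S_n$ of an integrable function being the $n$-th partial sum of its Vilenkin–Fourier series. Put $\|g\|_{L_{p,\infty}}=\sup_{\lambda>0}\lambda^p\mu(|g|>\lambda)$. In $\sigma_nf-f$ the martingale $f$ stands for its almost everywhere limit function $\lim_kf^{(k)}$. (a) For every $0<p<1/2$ there is a martingale $f\in H_p$, convergent almost everywhere, such that $\omega(1/M_N,f)_{H_p}=O\big(1/M_N^{1/p-2}\big)$ as $N\to\infty$, and $\|\sigma_nf-f\|_{L_{p,\infty}}\not\to0$ as $n\to\infty$. (b) There is a martingale $f\in H_{1/2}$, convergent almost everywhere, such that $\omega(1/M_N,f)_{H_{1/2}}=O(1/N^2)$ as $N\to\infty$, and $\|\sigma_nf-f\|_{1/2}\not\to0$ as $n\to\infty$. -/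

import Mathlib

open MeasureTheory Filter Topology
open scoped ENNReal ComplexConjugate

noncomputable section

namespace Vilenkin

/-- The Vilenkin group `G_m`, the complete direct product of the cyclic groups `ℤ / m_k ℤ`. -/
abbrev Group (m : ℕ → ℕ) : Type := ∀ k, ZMod (m k)

/-- The normalized Haar measure on `G_m`: the product of the uniform probability measures
on the cyclic factors. -/
def haar (m : ℕ → ℕ) [∀ k, NeZero (m k)] : Measure (Group m) :=
  Measure.infinitePi fun k => (PMF.uniformOfFintype (ZMod (m k))).toMeasure

instance instIsProbabilityMeasureHaar (m : ℕ → ℕ) [∀ k, NeZero (m k)] :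
    IsProbabilityMeasure (haar m) := by
  unfold haar; infer_instance

/-- The generalized powers `M_0 = 1`, `M_{k+1} = m_k M_k`. -/
def M (m : ℕ → ℕ) : ℕ → ℕ
  | 0 => 1
  | k + 1 => m k * M m k

/-- The `k`-th digit `n_k` of `n = ∑ n_j M_j`, `0 ≤ n_j < m_j`. -/
def digit (m : ℕ → ℕ) (n k : ℕ) : ℕ := n / M m k % m k

/-- The interval `I_n(x)`. -/
def interval (m : ℕ → ℕ) (n : ℕ) (x : Group m) : Set (Group m) :=
  {y | ∀ k < n, y k = x k}

/-- The generalized Rademacher function `r_k`. -/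
def rademacher (m : ℕ → ℕ) (k : ℕ) (x : Group m) : ℂ :=
  Complex.exp (2 * Real.pi * Complex.I * ((x k).val : ℂ) / (m k : ℂ))

/-- The Vilenkin function `ψ_n`; only finitely many factors differ from `1`. -/
def psi (m : ℕ → ℕ) (n : ℕ) (x : Group m) : ℂ :=
  ∏ᶠ k, rademacher m k x ^ digit m n k

theorem measurableSet_interval (m : ℕ → ℕ) (n : ℕ) (x : Group m) :
    MeasurableSet (interval m n x) := by
  have h : interval m n x = ⋂ k ∈ Finset.range n, (fun y : Group m => y k) ⁻¹' {x k} := by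
    ext y; simp [interval]
  rw [h]
  exact Finset.measurableSet_biInter _ fun k _ =>
    measurable_pi_apply k (MeasurableSet.singleton _)

/-- The σ-algebra `F_n` generated by the intervals `I_n(x)`, `x ∈ G_m`. -/
abbrev sigmaAlg (m : ℕ → ℕ) (n : ℕ) : MeasurableSpace (Group m) :=
  MeasurableSpace.generateFrom (Set.range (interval m n))

theorem sigmaAlg_le_succ (m : ℕ → ℕ) [∀ k, NeZero (m k)] (n : ℕ) :
    sigmaAlg m n ≤ sigmaAlg m (n + 1) := by
  refine MeasurableSpace.generateFrom_le ?_
  rintro _ ⟨x, rfl⟩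
  have h : interval m n x =
      ⋃ a : ZMod (m n), interval m (n + 1) (Function.update x n a) := by
    ext y
    simp only [interval, Set.mem_ofPred_eq, Set.mem_iUnion]
    constructor
    · intro hy
      refine ⟨y n, fun k hk => ?_⟩
      rcases Nat.lt_succ_iff_lt_or_eq.mp hk with hk | rfl
      · rw [Function.update_of_ne hk.ne]; exact hy k hk
      · simp
    · rintro ⟨a, ha⟩ k hk
      have := ha k (hk.trans (Nat.lt_succ_self n))
      rwa [Function.update_of_ne hk.ne] at this
  rw [h]
  exact @MeasurableSet.iUnion _ _ (sigmaAlg m (n + 1)) _ _ fun a =>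
    MeasurableSpace.measurableSet_generateFrom ⟨_, rfl⟩

/-- The filtration `(F_n)`. -/
def filtration (m : ℕ → ℕ) [∀ k, NeZero (m k)] :
    Filtration ℕ (inferInstance : MeasurableSpace (Group m)) where
  seq := sigmaAlg m
  mono' := monotone_nat_of_le_succ (sigmaAlg_le_succ m)
  le' n := by
    refine MeasurableSpace.generateFrom_le ?_
    rintro _ ⟨x, rfl⟩
    exact measurableSet_interval m n x

section

variable (m : ℕ → ℕ) [∀ k, NeZero (m k)]

/-- Vilenkin–Fourier coefficient of an integrable function. -/
def coeffFun (g : Group m → ℂ) (i : ℕ) : ℂ :=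
  ∫ x, g x * conj (psi m i x) ∂(haar m)

/-- Partial sum `S_n g` of the Vilenkin–Fourier series of an integrable function. -/
def partialSumFun (g : Group m → ℂ) (n : ℕ) (x : Group m) : ℂ :=
  ∑ i ∈ Finset.range n, coeffFun m g i * psi m i x

/-- Vilenkin–Fourier coefficient of a martingale: the limit of the coefficients of `f^(k)`
(for a martingale this sequence is eventually constant). -/
def coeff (f : ℕ → Group m → ℂ) (i : ℕ) : ℂ :=
  limUnder atTop fun k => coeffFun m (f k) i

/-- Partial sum `S_n f` of the Vilenkin–Fourier series of a martingale. -/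
def partialSum (f : ℕ → Group m → ℂ) (n : ℕ) (x : Group m) : ℂ :=
  ∑ i ∈ Finset.range n, coeff m f i * psi m i x

/-- Fejér mean `σ_n f = (1/n) ∑_{k=1}^n S_k f` of a martingale. -/
def fejer (f : ℕ → Group m → ℂ) (n : ℕ) (x : Group m) : ℂ :=
  (1 / (n : ℂ)) * ∑ k ∈ Finset.Icc 1 n, partialSum m f k x

/-- The `H_p` quasi-norm `‖f^*‖_p` with the maximal function `f^* = sup_n |f^(n)|`. -/
def hardyNorm (p : ℝ) (f : ℕ → Group m → ℂ) : ℝ≥0∞ :=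
  eLpNorm (fun x => ⨆ n, ‖f n x‖ₑ) (ENNReal.ofReal p) (haar m)

/-- `f` is a martingale with respect to `(F_n)` that belongs to `H_p`. -/
def MemHardy (p : ℝ) (f : ℕ → Group m → ℂ) : Prop :=
  Martingale f (filtration m) (haar m) ∧ hardyNorm m p f < ∞

/-- The modulus of continuity `ω(1/M_N, f)_{H_p} = ‖f - S_{M_N} f‖_{H_p}`, where
`f - S_{M_N} f` is the martingale `(f^(k) - S_{M_N} f^(k))_k`. -/
def modulus (p : ℝ) (f : ℕ → Group m → ℂ) (N : ℕ) : ℝ≥0∞ :=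
  hardyNorm m p fun k x => f k x - partialSumFun m (f k) (M m N) x

/-- The weak quasi-norm `sup_{t > 0} t^p μ(|g| > t)` of `L_{p,∞}`. -/
def weakNorm (p : ℝ) (g : Group m → ℂ) : ℝ≥0∞ :=
  ⨆ (t : ℝ) (_ : 0 < t), ENNReal.ofReal (t ^ p) * haar m {x | t < ‖g x‖}

/-- `g` is the function determined by the martingale `f`: its almost everywhere limit. -/
def IsLimitFunction (f : ℕ → Group m → ℂ) (g : Group m → ℂ) : Prop :=
  Measurable g ∧ ∀ᵐ x ∂(haar m), Tendsto (fun n => f n x) atTop (𝓝 (g x))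

end

end Vilenkin

end

/-! Both counterexamples have Vilenkin coefficients equal to a constant `c k` on each block `[M_k,
M_{k+1})`, so the martingale differences are `c k` times differences of the Dirichlet kernels of
orders `M_{k+1}` and `M_k`. These live on `I_k(0)`, a set of measure `1 / M_k`, and have size at
most `|c k| M_{k+1}`. For `p ≤ 1` the Hardy quasi-norm and the modulus are therefore controlled by
the series of `(|c k| M_{k+1})^p / M_k` (`hardyNorm_le`, `modulus_seriesMartingale_le`). Off the
null point `0` the martingale is eventually constant, so the limit function exists.

Divergence comes from second differences of `n ↦ n σ_n f` (`fejerSum_second_difference`). Their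
weights sum to zero, so any function `g` may be subtracted from every mean, and the difference
isolates a piece of the series. If that piece is too large, three means cannot all be close to `g`.

(a) Take `c k = M_k`. With step 1 the second difference is a single term of modulus `M_k`,
comparable to the weights, at every point.

(b) Take `c k = M_k / k^2` for `k = 3 · 2^j` only. With step `q = ∑_{j < 2^k} M_{3j}` at `M_α`, `α =
3 · 2^k`, the second difference is `c α` times a character times `q K_q`. The integral of `|q
K_q|^{1/2}` is at least a multiple of `2^k` (`le_lintegral_fejerKernel_sparseIndex`), which
compensates exactly for the factor `1/α` coming from the square root of `c α / M_α`. -/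

namespace Vilenkin

/-! ### Mixed-radix digits -/

section Digits

variable {m : ℕ → ℕ}

theorem M_succ (k : ℕ) : M m (k + 1) = m k * M m k := rfl

theorem M_dvd {j k : ℕ} (h : j ≤ k) : M m j ∣ M m k := by
  induction k, h using Nat.le_induction with
  | base => exact dvd_rfl
  | succ k _ ih => exact ih.mul_left _

theorem M_pos [∀ k, NeZero (m k)] (k : ℕ) : 0 < M m k := by
  induction k with
  | zero => exact one_pos
  | succ k ih => exact Nat.mul_pos (NeZero.pos _) ih

theorem M_mono [∀ k, NeZero (m k)] : Monotone (M m) := fun _ k h =>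
  Nat.le_of_dvd (M_pos k) (M_dvd h)

theorem two_mul_M_le (hm : ∀ k, 2 ≤ m k) (k : ℕ) : 2 * M m k ≤ M m (k + 1) :=
  Nat.mul_le_mul_right _ (hm k)

theorem two_pow_mul_M_le (hm : ∀ k, 2 ≤ m k) (N j : ℕ) : 2 ^ j * M m N ≤ M m (N + j) := by
  induction j with
  | zero => simp
  | succ j ih =>
    calc 2 ^ (j + 1) * M m N = 2 * (2 ^ j * M m N) := by ring
      _ ≤ 2 * M m (N + j) := Nat.mul_le_mul_left _ ih
      _ ≤ M m (N + (j + 1)) := two_mul_M_le hm _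

theorem lt_M (hm : ∀ k, 2 ≤ m k) (n : ℕ) : n < M m n := by
  have := two_pow_mul_M_le hm 0 n
  simp only [M, mul_one, zero_add] at this
  exact n.lt_two_pow_self.trans_le this

theorem digit_eq_zero_of_lt [∀ k, NeZero (m k)] {n t k : ℕ} (hn : n < M m t) (hk : t ≤ k) :
    digit m n k = 0 := by
  rw [digit, Nat.div_eq_of_lt (hn.trans_le (M_mono hk)), Nat.zero_mod]

theorem digit_lt [∀ k, NeZero (m k)] (n k : ℕ) : digit m n k < m k :=
  Nat.mod_lt _ (NeZero.pos _)

theorem digit_mul_M_of_lt [∀ k, NeZero (m k)] (c : ℕ) {t k : ℕ} (hk : k < t) :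
    digit m (c * M m t) k = 0 := by
  obtain ⟨d, hd⟩ := M_dvd (m := m) (Nat.succ_le_of_lt hk)
  rw [digit, hd, M_succ, show c * (m k * M m k * d) = m k * (c * d) * M m k by ring,
    Nat.mul_div_cancel _ (M_pos k), Nat.mul_mod_right]

/-- There are no carries: `i` uses only the positions below `t`, and `c * M m t` only those from `t`
on. -/
theorem digit_add_mul_M [∀ k, NeZero (m k)] {i t : ℕ} (hi : i < M m t) (c k : ℕ) :
    digit m (i + c * M m t) k = digit m i k + digit m (c * M m t) k := by
  rcases lt_or_ge k t with hk | hk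
  · rw [digit_mul_M_of_lt c hk, add_zero]
    obtain ⟨d, hd⟩ := M_dvd (m := m) (Nat.succ_le_of_lt hk)
    rw [digit, digit, hd, M_succ, show c * (m k * M m k * d) = M m k * (m k * (c * d)) by ring,
      Nat.add_mul_div_left _ _ (M_pos k), Nat.add_mul_mod_self_left]
  · rw [digit_eq_zero_of_lt hi hk, zero_add]
    obtain ⟨d, hd⟩ := M_dvd (m := m) hk
    rw [digit, digit, hd, ← Nat.div_div_eq_div_mul, ← Nat.div_div_eq_div_mul,
      Nat.add_mul_div_right _ _ (M_pos t), Nat.div_eq_of_lt hi, zero_add,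
      Nat.mul_div_cancel _ (M_pos t)]

theorem digit_mul_M_self [∀ k, NeZero (m k)] {u t : ℕ} (hu : u < m t) :
    digit m (u * M m t) t = u := by
  rw [digit, Nat.mul_div_cancel _ (M_pos t), Nat.mod_eq_of_lt hu]

/-- A number below `M_t` is determined by its first `t` digits. -/
theorem eq_of_digit_eq [∀ k, NeZero (m k)] {t : ℕ} : ∀ {i j : ℕ}, i < M m t → j < M m t →
    (∀ k < t, digit m i k = digit m j k) → i = j := by
  induction t with
  | zero => intro i j hi hj _; simp only [M, Nat.lt_one_iff] at hi hj; rw [hi, hj]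
  | succ t ih =>
    intro i j hi hj h
    have key : ∀ n : ℕ, n < M m (t + 1) → n = n % M m t + digit m n t * M m t := by
      intro n hn
      have : n / M m t < m t := Nat.div_lt_of_lt_mul (by rwa [M_succ, mul_comm] at hn)
      rw [digit, Nat.mod_eq_of_lt this, mul_comm, Nat.mod_add_div]
    have hmod : i % M m t = j % M m t := by
      refine ih (Nat.mod_lt _ (M_pos t)) (Nat.mod_lt _ (M_pos t)) fun k hk => ?_
      have h1 := digit_add_mul_M (Nat.mod_lt i (M_pos (m := m) t)) (digit m i t) k
      have h2 := digit_add_mul_M (Nat.mod_lt j (M_pos (m := m) t)) (digit m j t) k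
      rw [← key i hi, digit_mul_M_of_lt _ hk] at h1
      rw [← key j hj, digit_mul_M_of_lt _ hk] at h2
      have := h k (hk.trans t.lt_succ_self)
      omega
    rw [key i hi, key j hj, hmod, h t t.lt_succ_self]

end Digits

/-! ### Vilenkin functions, Dirichlet and Fejér kernels -/

section Characters

variable {m : ℕ → ℕ} [∀ k, NeZero (m k)]

theorem rademacher_eq_stdAddChar (k : ℕ) (x : Group m) :
    rademacher m k x = ZMod.stdAddChar (x k) := by
  rw [ZMod.stdAddChar_apply, ZMod.toCircle_apply, rademacher]

theorem norm_rademacher (k : ℕ) (x : Group m) : ‖rademacher m k x‖ = 1 := by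
  rw [rademacher_eq_stdAddChar, ZMod.stdAddChar_apply, Circle.norm_coe]

theorem rademacher_of_eq_zero {k : ℕ} {x : Group m} (h : x k = 0) : rademacher m k x = 1 := by
  rw [rademacher_eq_stdAddChar, h, AddChar.map_zero_eq_one]

theorem rademacher_pow_modulus (k : ℕ) (x : Group m) : rademacher m k x ^ m k = 1 := by
  rw [rademacher_eq_stdAddChar, ← AddChar.map_nsmul_eq_pow, nsmul_eq_mul, ZMod.natCast_self,
    zero_mul, AddChar.map_zero_eq_one]

theorem rademacher_eq_one_iff {k : ℕ} {x : Group m} : rademacher m k x = 1 ↔ x k = 0 := by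
  rw [rademacher_eq_stdAddChar, ← AddChar.map_zero_eq_one (ZMod.stdAddChar (N := m k))]
  exact ZMod.injective_stdAddChar.eq_iff

theorem sum_rademacher_pow (k : ℕ) (x : Group m) :
    ∑ u ∈ Finset.range (m k), rademacher m k x ^ u = if x k = 0 then (m k : ℂ) else 0 := by
  split_ifs with h
  · simp [rademacher_of_eq_zero h]
  · rw [geom_sum_eq (mt rademacher_eq_one_iff.1 h), rademacher_pow_modulus, sub_self, zero_div]

theorem psi_eq_prod {n t : ℕ} (hn : n < M m t) (x : Group m) :
    psi m n x = ∏ k ∈ Finset.range t, rademacher m k x ^ digit m n k := by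
  refine finprod_eq_prod_of_mulSupport_subset _ fun k hk => ?_
  by_contra h
  simp only [Finset.coe_range, Set.mem_Iio, not_lt] at h
  exact hk (by simp only [digit_eq_zero_of_lt hn h, pow_zero])

theorem lt_M_self_of_le (hm : ∀ k, 2 ≤ m k) {n t : ℕ} (h : n ≤ t) : n < M m t :=
  (lt_M hm n).trans_le (M_mono h)

theorem norm_psi (hm : ∀ k, 2 ≤ m k) (n : ℕ) (x : Group m) : ‖psi m n x‖ = 1 := by
  simp [psi_eq_prod (lt_M hm n), norm_rademacher]

theorem psi_zero (x : Group m) : psi m 0 x = 1 := by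
  rw [psi_eq_prod (t := 0) (by simp [M])]; simp

theorem psi_add_mul_M (hm : ∀ k, 2 ≤ m k) {i t : ℕ} (hi : i < M m t) (c : ℕ) (x : Group m) :
    psi m (i + c * M m t) x = psi m i x * psi m (c * M m t) x := by
  have h1 := lt_M hm (i + c * M m t)
  rw [psi_eq_prod h1, psi_eq_prod (lt_of_le_of_lt (Nat.le_add_right _ _) h1),
    psi_eq_prod (lt_of_le_of_lt (Nat.le_add_left _ _) h1), ← Finset.prod_mul_distrib]
  exact Finset.prod_congr rfl fun k _ => by rw [digit_add_mul_M hi, pow_add]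

theorem psi_mul_M {u t : ℕ} (hu : u < m t) (x : Group m) :
    psi m (u * M m t) x = rademacher m t x ^ u := by
  rw [psi_eq_prod (t := t + 1) (Nat.mul_lt_mul_of_pos_right hu (M_pos t)),
    Finset.prod_range_succ, digit_mul_M_self hu, Finset.prod_eq_one, one_mul]
  intro k hk
  rw [digit_mul_M_of_lt _ (Finset.mem_range.1 hk), pow_zero]

theorem psi_eq_one {n t : ℕ} (hn : n < M m t) {x : Group m} (hx : ∀ k < t, x k = 0) :
    psi m n x = 1 := by
  rw [psi_eq_prod hn]
  exact Finset.prod_eq_one fun k hk => by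
    rw [rademacher_of_eq_zero (hx k (Finset.mem_range.1 hk)), one_pow]

/-- Summation over a range of length `c * b` in `c` blocks of length `b`. -/
theorem sum_range_mul_eq {E : Type*} [AddCommMonoid E] (c b : ℕ) (F : ℕ → E) :
    ∑ i ∈ Finset.range (c * b), F i =
      ∑ u ∈ Finset.range c, ∑ i ∈ Finset.range b, F (i + u * b) := by
  induction c with
  | zero => simp
  | succ c ih =>
    rw [Nat.succ_mul, Finset.sum_range_add, ih, Finset.sum_range_succ]
    simp only [add_comm]

/-- The Dirichlet kernel `D_n = ∑_{i < n} ψ_i`. -/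
noncomputable def dirichletKernel (m : ℕ → ℕ) (n : ℕ) (x : Group m) : ℂ :=
  ∑ i ∈ Finset.range n, psi m i x

theorem dirichletKernel_M_succ (hm : ∀ k, 2 ≤ m k) (t : ℕ) (x : Group m) :
    dirichletKernel m (M m (t + 1)) x =
      dirichletKernel m (M m t) x * ∑ u ∈ Finset.range (m t), rademacher m t x ^ u := by
  rw [dirichletKernel, M_succ, sum_range_mul_eq, dirichletKernel, Finset.mul_sum]
  refine Finset.sum_congr rfl fun u hu => ?_
  rw [Finset.sum_mul]
  exact Finset.sum_congr rfl fun i hi => by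
    rw [psi_add_mul_M hm (Finset.mem_range.1 hi), psi_mul_M (Finset.mem_range.1 hu)]

/-- The kernel is a product of geometric sums of roots of unity, one per coordinate, each equal to
`m k` or `0`. -/
theorem dirichletKernel_M (hm : ∀ k, 2 ≤ m k) (t : ℕ) (x : Group m) :
    dirichletKernel m (M m t) x = if ∀ k < t, x k = 0 then (M m t : ℂ) else 0 := by
  induction t with
  | zero => simp [dirichletKernel, M, psi_zero]
  | succ t ih =>
    rw [dirichletKernel_M_succ hm, ih, sum_rademacher_pow]
    simp only [Nat.forall_lt_succ_right]
    by_cases h1 : ∀ k < t, x k = 0 <;> by_cases h2 : x t = 0 <;> simp [h1, h2, M_succ, mul_comm]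

theorem dirichletKernel_M_succ_eq_zero (hm : ∀ k, 2 ≤ m k) {t : ℕ} {x : Group m} (h : x t ≠ 0) :
    dirichletKernel m (M m (t + 1)) x = 0 := by
  rw [dirichletKernel_M_succ hm, sum_rademacher_pow, if_neg h, mul_zero]

theorem sum_natCast_mul_psi_M_succ (hm : ∀ k, 2 ≤ m k) (t : ℕ) (x : Group m) :
    ∑ i ∈ Finset.range (M m (t + 1)), (i : ℂ) * psi m i x =
      (∑ i ∈ Finset.range (M m t), (i : ℂ) * psi m i x) *
          ∑ u ∈ Finset.range (m t), rademacher m t x ^ u +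
        dirichletKernel m (M m t) x *
          ∑ u ∈ Finset.range (m t), (u * M m t : ℂ) * rademacher m t x ^ u := by
  rw [M_succ, sum_range_mul_eq, dirichletKernel, Finset.mul_sum, Finset.mul_sum,
    ← Finset.sum_add_distrib]
  refine Finset.sum_congr rfl fun u hu => ?_
  rw [Finset.sum_mul, Finset.sum_mul, ← Finset.sum_add_distrib]
  refine Finset.sum_congr rfl fun i hi => ?_
  rw [psi_add_mul_M hm (Finset.mem_range.1 hi), psi_mul_M (Finset.mem_range.1 hu)]
  push_cast
  ring

/-- In the block recursion `x (t + 1) ≠ 0` kills the geometric sum of the first term and `x t ≠ 0`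
kills the Dirichlet kernel of the second. Hence the demand for two consecutive nonzero coordinates.
-/
theorem sum_natCast_mul_psi_eq_zero (hm : ∀ k, 2 ≤ m k) {t : ℕ} {x : Group m} (h : x t ≠ 0)
    (h' : x (t + 1) ≠ 0) : ∑ i ∈ Finset.range (M m (t + 2)), (i : ℂ) * psi m i x = 0 := by
  rw [sum_natCast_mul_psi_M_succ hm, sum_rademacher_pow, if_neg h',
    dirichletKernel_M_succ_eq_zero hm h, mul_zero, zero_mul, add_zero]

/-- The unnormalized Fejér kernel `n K_n = ∑_{i < n} (n - i) ψ_i`. -/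
noncomputable def fejerKernel (m : ℕ → ℕ) (n : ℕ) (x : Group m) : ℂ :=
  ∑ i ∈ Finset.range n, ((n : ℂ) - i) * psi m i x

/-- Where two consecutive coordinates `x_t, x_{t+1}` do not vanish, the blocks of length `M_{t+2}`
do not contribute to the Fejér kernel. -/
theorem fejerKernel_add_mul_M (hm : ∀ k, 2 ≤ m k) {t : ℕ} {x : Group m} (h : x t ≠ 0)
    (h' : x (t + 1) ≠ 0) {r : ℕ} (hr : r ≤ M m (t + 2)) (c : ℕ) :
    fejerKernel m (r + c * M m (t + 2)) x =
      psi m (c * M m (t + 2)) x * fejerKernel m r x := by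
  have hD : ∑ i ∈ Finset.range (M m (t + 2)), psi m i x = 0 :=
    dirichletKernel_M_succ_eq_zero hm h'
  have hB := sum_natCast_mul_psi_eq_zero hm h h'
  rw [fejerKernel, add_comm r, Finset.sum_range_add, sum_range_mul_eq, Finset.sum_eq_zero,
    zero_add, fejerKernel, Finset.mul_sum]
  · refine Finset.sum_congr rfl fun i hi => ?_
    rw [add_comm (c * _) i, psi_add_mul_M hm ((Finset.mem_range.1 hi).trans_le hr)]
    push_cast
    ring
  -- On a full block the weight is affine in the position, so the block sum combines the zeroth and
  -- first moments of the characters; both vanish.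
  · intro u _
    have : ∀ i ∈ Finset.range (M m (t + 2)),
        (((c * M m (t + 2) + r : ℕ) : ℂ) - ((i + u * M m (t + 2) : ℕ) : ℂ)) *
            psi m (i + u * M m (t + 2)) x =
          (((c * M m (t + 2) + r : ℕ) : ℂ) - (u * M m (t + 2) : ℕ)) *
              psi m (u * M m (t + 2)) x * psi m i x -
            psi m (u * M m (t + 2)) x * ((i : ℂ) * psi m i x) := by
      intro i hi
      rw [psi_add_mul_M hm (Finset.mem_range.1 hi)]
      push_cast
      ring
    rw [Finset.sum_congr rfl this, Finset.sum_sub_distrib, ← Finset.mul_sum, ← Finset.mul_sum,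
      hD, hB, mul_zero, mul_zero, sub_zero]

theorem fejerKernel_of_eq_zero {t r : ℕ} (hr : r ≤ M m t) {x : Group m} (hx : ∀ k < t, x k = 0) :
    fejerKernel m r x = (r : ℂ) * (r + 1) / 2 := by
  have h1 : fejerKernel m r x = ∑ i ∈ Finset.range r, ((r : ℂ) - i) :=
    Finset.sum_congr rfl fun i hi => by
      rw [psi_eq_one ((Finset.mem_range.1 hi).trans_le hr) hx, mul_one]
  have h2 : ∀ n : ℕ, ∑ i ∈ Finset.range n, (i : ℂ) = n * (n - 1) / 2 := by
    intro n
    induction n with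
    | zero => simp
    | succ n ih => rw [Finset.sum_range_succ, ih]; push_cast; ring
  rw [h1, Finset.sum_sub_distrib, h2, Finset.sum_const, Finset.card_range, nsmul_eq_mul]
  ring

end Characters

end Vilenkin

/-! ### Intervals and measurability -/

namespace Vilenkin

/-- Two intervals of the same order that meet coincide. -/
theorem isPiSystem_range_interval (m : ℕ → ℕ) (n : ℕ) :
    IsPiSystem (Set.range (interval m n)) := by
  rintro _ ⟨x, rfl⟩ _ ⟨y, rfl⟩ ⟨z, hzx, hzy⟩
  refine ⟨z, Set.Subset.antisymm (fun w hw => ⟨fun k hk => ?_, fun k hk => ?_⟩) ?_⟩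
  · rw [hw k hk, hzx k hk]
  · rw [hw k hk, hzy k hk]
  · rintro w ⟨hw, -⟩ k hk
    rw [hw k hk, hzx k hk]

variable {m : ℕ → ℕ} [∀ k, NeZero (m k)]

theorem rademacher_sub (k : ℕ) (x y : Group m) :
    rademacher m k (x - y) = rademacher m k x * conj (rademacher m k y) := by
  rw [← Complex.inv_eq_conj (norm_rademacher k y), rademacher_eq_stdAddChar,
    rademacher_eq_stdAddChar, rademacher_eq_stdAddChar, Pi.sub_apply, AddChar.map_sub_eq_div,
    div_eq_mul_inv]

theorem psi_sub (hm : ∀ k, 2 ≤ m k) (n : ℕ) (x y : Group m) :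
    psi m n (x - y) = psi m n x * conj (psi m n y) := by
  simp only [psi_eq_prod (lt_M hm n), map_prod, map_pow, rademacher_sub, mul_pow,
    Finset.prod_mul_distrib]

/-- This is the Dirichlet kernel of order `M_n` at `x - y`. It turns integrals over intervals into
orthogonality relations. -/
theorem indicator_interval_eq_sum (hm : ∀ k, 2 ≤ m k) (n : ℕ) (y x : Group m) :
    (interval m n y).indicator (fun _ => (1 : ℂ)) x =
      (M m n : ℂ)⁻¹ * ∑ i ∈ Finset.range (M m n), psi m i x * conj (psi m i y) := by
  have h := dirichletKernel_M hm n (x - y)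
  simp only [dirichletKernel, psi_sub hm] at h
  have h0 : (M m n : ℂ) ≠ 0 := Nat.cast_ne_zero.2 (M_pos n).ne'
  rw [h]
  by_cases hx : x ∈ interval m n y
  · have hxy : ∀ k < n, (x - y) k = 0 := fun k hk => sub_eq_zero.2 (hx k hk)
    rw [Set.indicator_of_mem hx, if_pos hxy, inv_mul_cancel₀ h0]
  · have hxy : ¬∀ k < n, (x - y) k = 0 := fun h => hx fun k hk => sub_eq_zero.1 (h k hk)
    rw [Set.indicator_of_notMem hx, if_neg hxy, mul_zero]

section Measurability

/-- A set that is a union of intervals of order `n` belongs to `F_n`. -/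
theorem measurableSet_sigmaAlg {n : ℕ} {s : Set (Group m)}
    (h : ∀ x ∈ s, interval m n x ⊆ s) : MeasurableSet[sigmaAlg m n] s := by
  classical
  -- Extending finite strings by zeros gives one representative per interval, so a countable union
  -- suffices.
  let e : (∀ j : Fin n, ZMod (m j)) → Group m := fun z k => if h : k < n then z ⟨k, h⟩ else 0
  have hs : s = ⋃ z ∈ e ⁻¹' s, interval m n (e z) := by
    refine Set.Subset.antisymm (fun x hx => ?_) (Set.iUnion₂_subset fun z hz => h _ hz)
    have he : e (fun j => x j) ∈ interval m n x := fun k hk => by simp [e, hk]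
    exact Set.mem_iUnion₂.2 ⟨fun j => x j, h x hx he, fun k hk => (he k hk).symm⟩
  rw [hs]
  exact @MeasurableSet.biUnion _ _ (sigmaAlg m n) _ _ (Set.to_countable _) fun z _ =>
    MeasurableSpace.measurableSet_generateFrom ⟨_, rfl⟩

theorem measurable_sigmaAlg {E : Type*} [MeasurableSpace E] {n : ℕ} {F : Group m → E}
    (h : ∀ x y, y ∈ interval m n x → F y = F x) : Measurable[sigmaAlg m n] F :=
  fun s _ => measurableSet_sigmaAlg fun x hx y hy => by
    rw [Set.mem_preimage, h x y hy]; exact hx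

theorem measurable_psi_sigmaAlg {i n : ℕ} (hi : i < M m n) :
    Measurable[sigmaAlg m n] (psi m i) := by
  refine measurable_sigmaAlg fun x y h => ?_
  rw [psi_eq_prod hi, psi_eq_prod hi]
  exact Finset.prod_congr rfl fun k hk => by
    rw [rademacher, rademacher, h k (Finset.mem_range.1 hk)]

theorem measurable_psi (hm : ∀ k, 2 ≤ m k) (i : ℕ) : Measurable (psi m i) :=
  (measurable_psi_sigmaAlg (lt_M hm i)).mono ((filtration m).le i) le_rfl

theorem integrable_psi (hm : ∀ k, 2 ≤ m k) (i : ℕ) : Integrable (psi m i) (haar m) :=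
  .of_bound (measurable_psi hm i).aestronglyMeasurable 1 (ae_of_all _ fun x => (norm_psi hm i x).le)

theorem integrable_psi_mul_conj (hm : ∀ k, 2 ≤ m k) (i j : ℕ) :
    Integrable (fun x => psi m i x * conj (psi m j x)) (haar m) := by
  refine .of_bound ?_ 1 (ae_of_all _ fun x => ?_)
  · exact ((measurable_psi hm i).mul
      (Complex.continuous_conj.measurable.comp (measurable_psi hm j))).aestronglyMeasurable
  · rw [norm_mul, RCLike.norm_conj, norm_psi hm, norm_psi hm, one_mul]

end Measurability

/-! ### Orthogonality and Haar measure of cylinder sets -/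

section Integration

theorem integral_prod_haar (t : ℕ) (g : ∀ k, ZMod (m k) → ℂ) :
    ∫ x, ∏ k ∈ Finset.range t, g k (x k) ∂(haar m) =
      ∏ k ∈ Finset.range t, (m k : ℂ)⁻¹ * ∑ z, g k z := by
  have h := integral_restrict_infinitePi
    (μ := fun k => (PMF.uniformOfFintype (ZMod (m k))).toMeasure) (s := Finset.range t)
    (f := fun y => ∏ k : Finset.range t, g k (y k)) (by
      refine Measurable.aestronglyMeasurable ?_
      exact Finset.measurable_prod _ fun k _ => measurable_from_top.comp (measurable_pi_apply k))
  rw [integral_fintype_prod_eq_prod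
    (f := fun (k : Finset.range t) (z : ZMod (m k)) => g k z)] at h
  simp only [Finset.restrict] at h
  rw [Finset.univ_eq_attach, 
    Finset.prod_attach _ fun k => ∫ z, g k z ∂(PMF.uniformOfFintype (ZMod (m k))).toMeasure] at h
  rw [haar]
  convert h using 1
  · refine integral_congr_ae (ae_of_all _ fun x => ?_)
    exact (Finset.prod_attach _ (fun k => g k (x k))).symm
  · refine Finset.prod_congr rfl fun k _ => ?_
    rw [PMF.integral_eq_sum, Finset.mul_sum]
    simp [ZMod.card, Complex.real_smul]

theorem sum_stdAddChar_pow_mul_conj {N a b : ℕ} [NeZero N] (ha : a < N) (hb : b < N) :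
    ∑ z : ZMod N, ZMod.stdAddChar z ^ a * conj (ZMod.stdAddChar z ^ b) =
      if a = b then (N : ℂ) else 0 := by
  have h := AddChar.sum_mulShift ((a : ZMod N) - b) (ZMod.isPrimitive_stdAddChar N)
  have hab : (a : ZMod N) - b = 0 ↔ a = b := by
    rw [sub_eq_zero, ZMod.natCast_eq_natCast_iff]
    exact ⟨fun h => Nat.ModEq.eq_of_lt_of_lt h ha hb, fun h => h ▸ rfl⟩
  simp only [hab, ZMod.card] at h
  convert h using 1
  · refine Finset.sum_congr rfl fun z _ => ?_
    have hz : ‖ZMod.stdAddChar z ^ b‖ = 1 := by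
      rw [norm_pow, ZMod.stdAddChar_apply, Circle.norm_coe, one_pow]
    rw [← Complex.inv_eq_conj hz, mul_sub, AddChar.map_sub_eq_div, div_eq_mul_inv,
      mul_comm z, mul_comm z, ← nsmul_eq_mul, ← nsmul_eq_mul, AddChar.map_nsmul_eq_pow,
      AddChar.map_nsmul_eq_pow]
  · split_ifs <;> simp

theorem integral_psi_mul_conj (hm : ∀ k, 2 ≤ m k) (i j : ℕ) :
    ∫ x, psi m i x * conj (psi m j x) ∂(haar m) = if i = j then 1 else 0 := by
  have hi : i < M m (max i j) := (lt_M hm i).trans_le (M_mono (le_max_left _ _))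
  have hj : j < M m (max i j) := (lt_M hm j).trans_le (M_mono (le_max_right _ _))
  have h := integral_prod_haar (m := m) (max i j) fun k z =>
    ZMod.stdAddChar z ^ digit m i k * conj (ZMod.stdAddChar z ^ digit m j k)
  simp only [sum_stdAddChar_pow_mul_conj (digit_lt _ _) (digit_lt _ _)] at h
  have hint : (fun x => psi m i x * conj (psi m j x)) = fun x : Group m =>
      ∏ k ∈ Finset.range (max i j), ZMod.stdAddChar (x k) ^ digit m i k *
        conj (ZMod.stdAddChar (x k) ^ digit m j k) := by
    ext x
    rw [psi_eq_prod hi, psi_eq_prod hj, map_prod, ← Finset.prod_mul_distrib]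
    simp only [rademacher_eq_stdAddChar]
  rw [hint, h]
  split_ifs with hij
  · subst hij
    refine Finset.prod_eq_one fun k _ => ?_
    rw [if_pos rfl, inv_mul_cancel₀ (NeZero.ne _)]
  · have : ∃ k < max i j, digit m i k ≠ digit m j k := by
      by_contra! hcon
      exact hij (eq_of_digit_eq hi hj hcon)
    obtain ⟨k, hk, hne⟩ := this
    exact Finset.prod_eq_zero (Finset.mem_range.2 hk) (by rw [if_neg hne, mul_zero])

/-- The indicator of an interval of order `n` is a combination of `ψ_i` with `i < M_n`, all
orthogonal to `ψ_j`. -/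
theorem setIntegral_interval_psi (hm : ∀ k, 2 ≤ m k) {n j : ℕ} (hj : M m n ≤ j) (y : Group m) :
    ∫ x in interval m n y, psi m j x ∂(haar m) = 0 := by
  rw [← integral_indicator (measurableSet_interval m n y)]
  have h : ∀ x, (interval m n y).indicator (psi m j) x =
      ∑ i ∈ Finset.range (M m n), (M m n : ℂ)⁻¹ * psi m i y *
        (psi m j x * conj (psi m i x)) := by
    intro x
    have hind := congrArg conj (indicator_interval_eq_sum hm n y x)
    have h1 : (interval m n y).indicator (psi m j) x =
        conj ((interval m n y).indicator (fun _ => (1 : ℂ)) x) * psi m j x := by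
      by_cases hx : x ∈ interval m n y <;> simp [hx]
    rw [h1, hind, map_mul, map_inv₀, Complex.conj_natCast, map_sum, Finset.mul_sum, Finset.sum_mul]
    refine Finset.sum_congr rfl fun i _ => ?_
    rw [map_mul, Complex.conj_conj]
    ring
  simp only [h]
  rw [integral_finsetSum _ fun i _ => (integrable_psi_mul_conj hm j i).const_mul _]
  refine Finset.sum_eq_zero fun i hi => ?_
  rw [integral_const_mul, integral_psi_mul_conj hm,
    if_neg ((Finset.mem_range.1 hi).trans_le hj).ne', mul_zero]

theorem setIntegral_psi (hm : ∀ k, 2 ≤ m k) {n j : ℕ} (hj : M m n ≤ j) {s : Set (Group m)}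
    (hs : MeasurableSet[sigmaAlg m n] s) : ∫ x in s, psi m j x ∂(haar m) = 0 := by
  have hle : sigmaAlg m n ≤ MeasurableSpace.pi := (filtration m).le n
  have huniv : ∫ x, psi m j x ∂(haar m) = 0 := by
    have h := integral_psi_mul_conj hm j 0
    rw [if_neg ((M_pos n).trans_le hj).ne'] at h
    simpa [psi_zero] using h
  refine MeasurableSpace.induction_on_inter (m := sigmaAlg m n)
    (C := fun s _ => ∫ x in s, psi m j x ∂(haar m) = 0) rfl (isPiSystem_range_interval m n)
    (by simp) ?_ ?_ ?_ s hs
  · rintro _ ⟨y, rfl⟩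
    exact setIntegral_interval_psi hm hj y
  · intro t ht ih
    have := integral_add_compl (hle _ ht) (integrable_psi hm j)
    rwa [ih, huniv, zero_add] at this
  · intro f hd hf ih
    rw [integral_iUnion (fun i => hle _ (hf i)) hd (integrable_psi hm j).integrableOn]
    simp [ih]

theorem haar_pi (t : ℕ) (s : ∀ k, Finset (ZMod (m k))) :
    haar m {x | ∀ k < t, x k ∈ s k} =
      ∏ k ∈ Finset.range t, ((s k).card : ℝ≥0∞) / (m k : ℝ≥0∞) := by
  have h := Measure.infinitePi_pi (fun k => (PMF.uniformOfFintype (ZMod (m k))).toMeasure)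
    (s := Finset.range t) (t := fun k => (s k : Set (ZMod (m k)))) fun k _ => (s k).measurableSet
  have hset : {x : Group m | ∀ k < t, x k ∈ s k} =
      Set.pi (Finset.range t : Set ℕ) fun k => (s k : Set (ZMod (m k))) := by
    ext x; simp [Set.mem_pi]
  rw [haar, hset, h]
  refine Finset.prod_congr rfl fun k _ => ?_
  rw [PMF.toMeasure_uniformOfFintype_apply _ (s k).measurableSet, ZMod.card]
  simp

theorem haar_forall_eq_zero (t : ℕ) :
    haar m {x | ∀ k < t, x k = 0} = (M m t : ℝ≥0∞)⁻¹ := by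
  have h := haar_pi (m := m) t fun k => {0}
  simp only [Finset.mem_singleton, Finset.card_singleton, Nat.cast_one, one_div] at h
  rw [h]
  clear h
  induction t with
  | zero => simp [M]
  | succ t ih =>
    rw [Finset.prod_range_succ, ih, M_succ, Nat.cast_mul, mul_comm, ENNReal.mul_inv]
    · exact Or.inl (Nat.cast_ne_zero.2 (NeZero.ne _))
    · exact Or.inl (ENNReal.natCast_ne_top _)

/-- The set of points with exactly `t` leading zeros for which also `x_{t+1}` does not vanish. -/
def leadingSet (m : ℕ → ℕ) (t : ℕ) : Set (Group m) :=
  {x | (∀ k < t, x k = 0) ∧ x t ≠ 0 ∧ x (t + 1) ≠ 0}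

theorem measurableSet_leadingSet (t : ℕ) : MeasurableSet (leadingSet m t) :=
  (filtration m).le (t + 2) _ <| measurableSet_sigmaAlg fun x hx y hy =>
    ⟨fun k hk => (hy k (by omega)).trans (hx.1 k hk), by rw [hy t (by omega)]; exact hx.2.1,
      by rw [hy (t + 1) (by omega)]; exact hx.2.2⟩

/-- The vanishing coordinates contribute `1 / M_t`; each nonvanishing one contributes `(m k - 1) / m
k ≥ 1/2`. -/
theorem le_haar_leadingSet (hm : ∀ k, 2 ≤ m k) (t : ℕ) :
    (M m t : ℝ≥0∞)⁻¹ * (2⁻¹ * 2⁻¹) ≤ haar m (leadingSet m t) := by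
  have hset : leadingSet m t =
      {x | ∀ k < t + 2, x k ∈ if k < t then {0} else (Finset.univ.erase (0 : ZMod (m k)))} := by
    ext x
    simp only [leadingSet, Set.mem_ofPred_eq]
    constructor
    · rintro ⟨h0, h1, h2⟩ k hk
      split_ifs with hkt
      · simp [h0 k hkt]
      · obtain rfl | rfl : k = t ∨ k = t + 1 := by omega
        · simpa using h1
        · simpa using h2
    · intro h
      refine ⟨fun k hk => by simpa [hk] using h k (by omega), ?_, ?_⟩
      · simpa using h t (by omega)
      · simpa using h (t + 1) (by omega)
  have hhalf : ∀ k, (2 : ℝ≥0∞)⁻¹ ≤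
      ((Finset.univ.erase (0 : ZMod (m k))).card : ℝ≥0∞) / (m k : ℝ≥0∞) := by
    intro k
    rw [Finset.card_erase_of_mem (Finset.mem_univ _), Finset.card_univ, ZMod.card,
      ENNReal.le_div_iff_mul_le (Or.inl (Nat.cast_ne_zero.2 (NeZero.ne _)))
        (Or.inl (ENNReal.natCast_ne_top _)), mul_comm, ← div_eq_mul_inv]
    refine ENNReal.div_le_of_le_mul ?_
    have := hm k
    exact_mod_cast (by omega : m k ≤ (m k - 1) * 2)
  have h0 := haar_forall_eq_zero (m := m) t
  have h1 := haar_pi (m := m) t fun k => {0}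
  simp only [Finset.mem_singleton] at h1
  rw [hset, haar_pi, Finset.prod_range_succ, Finset.prod_range_succ, mul_assoc, ← h0, h1]
  refine mul_le_mul' (le_of_eq ?_) (mul_le_mul' ?_ ?_)
  · exact Finset.prod_congr rfl fun k hk => by rw [if_pos (Finset.mem_range.1 hk)]
  · rw [if_neg (lt_irrefl t)]; exact hhalf t
  · rw [if_neg (by omega)]; exact hhalf (t + 1)

theorem ae_exists_ne_zero (hm : ∀ k, 2 ≤ m k) : ∀ᵐ x ∂(haar m), ∃ k, x k ≠ 0 := by
  rw [ae_iff]
  refine le_antisymm (ge_of_tendsto' (f := fun n : ℕ => (n : ℝ≥0∞)⁻¹) (x := atTop)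
    ENNReal.tendsto_inv_nat_nhds_zero fun n => ?_) zero_le
  calc haar m {x | ¬∃ k, x k ≠ 0} ≤ haar m {x | ∀ k < n, x k = 0} :=
        measure_mono fun x hx k _ => not_not.1 fun h => hx ⟨k, h⟩
    _ = (M m n : ℝ≥0∞)⁻¹ := haar_forall_eq_zero n
    _ ≤ (n : ℝ≥0∞)⁻¹ := ENNReal.inv_le_inv.2 (Nat.cast_le.2 (lt_M hm n).le)

end Integration

end Vilenkin

/-! ### Martingales of Vilenkin series and their Fejér sums -/

namespace Vilenkin

variable {m : ℕ → ℕ} [∀ k, NeZero (m k)]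

section Series

/-- The partial sums `∑_{i < n} a_i ψ_i` of a Vilenkin series. -/
noncomputable def seriesSum (m : ℕ → ℕ) (a : ℕ → ℂ) (n : ℕ) (x : Group m) : ℂ :=
  ∑ i ∈ Finset.range n, a i * psi m i x

/-- The martingale of the partial sums of order `M_n` of a Vilenkin series. -/
noncomputable def seriesMartingale (m : ℕ → ℕ) (a : ℕ → ℂ) (n : ℕ) (x : Group m) : ℂ :=
  seriesSum m a (M m n) x

theorem integrable_seriesSum (hm : ∀ k, 2 ≤ m k) (a : ℕ → ℂ) (n : ℕ) :
    Integrable (seriesSum m a n) (haar m) :=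
  integrable_finsetSum _ fun i _ => (integrable_psi hm i).const_mul _

theorem measurable_seriesMartingale (hm : ∀ k, 2 ≤ m k) (a : ℕ → ℂ) (n : ℕ) :
    Measurable (seriesMartingale m a n) := by
  unfold seriesMartingale seriesSum
  exact Finset.measurable_sum _ fun i _ => (measurable_psi hm i).const_mul _

/-- The increment from `n` to `n + 1` involves only `ψ_i` with `i ≥ M_n`, which integrate to zero
over sets of `F_n`. -/
theorem martingale_seriesMartingale (hm : ∀ k, 2 ≤ m k) (a : ℕ → ℂ) :
    Martingale (seriesMartingale m a) (filtration m) (haar m) := by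
  refine martingale_of_setIntegral_eq_succ (fun n => ?_)
    (fun n => integrable_seriesSum hm a (M m n)) fun n s hs => ?_
  · refine Measurable.stronglyMeasurable ?_
    unfold seriesMartingale seriesSum
    exact Finset.measurable_sum _ fun i hi =>
      (measurable_psi_sigmaAlg (Finset.mem_range.1 hi)).const_mul _
  · have hsplit : ∀ x, seriesMartingale m a (n + 1) x = seriesMartingale m a n x +
        ∑ i ∈ Finset.Ico (M m n) (M m (n + 1)), a i * psi m i x := fun x =>
      (Finset.sum_range_add_sum_Ico _ (M_mono n.le_succ)).symm
    have hint : ∀ i, Integrable (fun x => a i * psi m i x) ((haar m).restrict s) := fun i =>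
      ((integrable_psi hm i).const_mul _).restrict
    simp only [hsplit]
    rw [integral_add (f := seriesMartingale m a n) (integrable_seriesSum hm a _).restrict
      (integrable_finsetSum _ fun i _ => hint i), integral_finsetSum _ fun i _ => hint i,
      Finset.sum_eq_zero, add_zero]
    intro i hi
    rw [integral_const_mul, setIntegral_psi hm (Finset.mem_Ico.1 hi).1 hs, mul_zero]

theorem coeffFun_seriesSum (hm : ∀ k, 2 ≤ m k) (a : ℕ → ℂ) (n i : ℕ) :
    coeffFun m (seriesSum m a n) i = if i < n then a i else 0 := by
  have h : ∀ x, seriesSum m a n x * conj (psi m i x) =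
      ∑ j ∈ Finset.range n, a j * (psi m j x * conj (psi m i x)) := fun x => by
    rw [seriesSum, Finset.sum_mul]
    exact Finset.sum_congr rfl fun j _ => mul_assoc _ _ _
  rw [coeffFun]
  simp only [h]
  rw [integral_finsetSum _ fun j _ => (integrable_psi_mul_conj hm j i).const_mul _]
  simp [integral_const_mul, integral_psi_mul_conj hm]

theorem coeff_seriesMartingale (hm : ∀ k, 2 ≤ m k) (a : ℕ → ℂ) (i : ℕ) :
    coeff m (seriesMartingale m a) i = a i := by
  refine Tendsto.limUnder_eq (tendsto_const_nhds.congr' ?_)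
  filter_upwards [eventually_ge_atTop i] with k hk
  exact ((coeffFun_seriesSum hm a (M m k) i).trans (if_pos (lt_M_self_of_le hm hk))).symm

theorem partialSum_seriesMartingale (hm : ∀ k, 2 ≤ m k) (a : ℕ → ℂ) (n : ℕ) (x : Group m) :
    partialSum m (seriesMartingale m a) n x = seriesSum m a n x := by
  simp only [partialSum, coeff_seriesMartingale hm, seriesSum]

theorem partialSumFun_seriesMartingale (hm : ∀ k, 2 ≤ m k) (a : ℕ → ℂ) (k N : ℕ) (x : Group m) :
    partialSumFun m (seriesMartingale m a k) (M m N) x = seriesMartingale m a (min N k) x := by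
  have h : ∀ i, coeffFun m (seriesMartingale m a k) i = if i < M m k then a i else 0 :=
    coeffFun_seriesSum hm a (M m k)
  simp only [partialSumFun, h, ite_mul, zero_mul]
  rw [← Finset.sum_filter, seriesMartingale, seriesSum]
  refine Finset.sum_congr ?_ fun _ _ => rfl
  ext i
  rw [Finset.mem_filter, Finset.mem_range, Finset.mem_range, M_mono.map_min, lt_min_iff]

/-- The unnormalized Fejér means `∑_{k=1}^n ∑_{i<k} a_i ψ_i` of a Vilenkin series. -/
noncomputable def fejerSum (m : ℕ → ℕ) (a : ℕ → ℂ) (n : ℕ) (x : Group m) : ℂ :=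
  ∑ k ∈ Finset.Icc 1 n, seriesSum m a k x

theorem natCast_mul_fejer (hm : ∀ k, 2 ≤ m k) (a : ℕ → ℂ) (n : ℕ) (x : Group m) :
    (n : ℂ) * fejer m (seriesMartingale m a) n x = fejerSum m a n x := by
  simp only [fejer, partialSum_seriesMartingale hm, fejerSum]
  rcases eq_or_ne n 0 with rfl | hn
  · simp
  · rw [← mul_assoc, mul_one_div_cancel (Nat.cast_ne_zero.2 hn), one_mul]

theorem seriesSum_add (m : ℕ → ℕ) (a : ℕ → ℂ) (n q : ℕ) (x : Group m) :
    seriesSum m a (n + q) x = seriesSum m a n x +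
      ∑ i ∈ Finset.range q, a (n + i) * psi m (n + i) x :=
  Finset.sum_range_add _ _ _

theorem fejerSum_add (m : ℕ → ℕ) (a : ℕ → ℂ) (n q : ℕ) (x : Group m) :
    fejerSum m a (n + q) x = fejerSum m a n x + q * seriesSum m a n x +
      ∑ i ∈ Finset.range q, ((q : ℂ) - i) * (a (n + i) * psi m (n + i) x) := by
  induction q with
  | zero => simp
  | succ q ih =>
    have h1 : fejerSum m a (n + (q + 1)) x =
        fejerSum m a (n + q) x + seriesSum m a (n + (q + 1)) x :=
      Finset.sum_Icc_succ_top (by omega) _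
    have h2 : ∑ i ∈ Finset.range (q + 1), (((q + 1 : ℕ) : ℂ) - i) * (a (n + i) * psi m (n + i) x) =
        ∑ i ∈ Finset.range q, ((q : ℂ) - i) * (a (n + i) * psi m (n + i) x) +
          ∑ i ∈ Finset.range (q + 1), a (n + i) * psi m (n + i) x := by
      rw [Finset.sum_range_succ, Finset.sum_range_succ, ← add_assoc, ← Finset.sum_add_distrib]
      refine congrArg₂ _ (Finset.sum_congr rfl fun i _ => ?_) ?_ <;> push_cast <;> ring
    rw [h1, ih, h2, seriesSum_add]
    push_cast
    ring

/-- If the coefficients vanish on `(n, n + q)`, then the second difference of the Fejér sums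
with step `q` at `n + q` involves only the coefficients in `[n + q, n + 2 q)`. -/
theorem fejerSum_second_difference (m : ℕ → ℕ) (a : ℕ → ℂ) {n q : ℕ}
    (ha : ∀ i < q, 0 < i → a (n + i) = 0) (x : Group m) :
    fejerSum m a (n + q + q) x - 2 * fejerSum m a (n + q) x + fejerSum m a n x =
      ∑ i ∈ Finset.range q, ((q : ℂ) - i) * (a (n + q + i) * psi m (n + q + i) x) := by
  -- The term `i = 0` may survive, but its weight is already `q`; so the coefficient at `n` itself
  -- is unrestricted.
  have h : ∑ i ∈ Finset.range q, ((q : ℂ) - i) * (a (n + i) * psi m (n + i) x) =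
      q * ∑ i ∈ Finset.range q, a (n + i) * psi m (n + i) x := by
    rw [Finset.mul_sum]
    refine Finset.sum_congr rfl fun i hi => ?_
    rcases i.eq_zero_or_pos with rfl | h0
    · simp
    · rw [ha i (Finset.mem_range.1 hi) h0, zero_mul, mul_zero, mul_zero]
  rw [fejerSum_add m a (n + q) q, fejerSum_add m a n q, h, seriesSum_add m a n q]
  ring

end Series

end Vilenkin

/-! ### Block martingales: Hardy quasi-norm, modulus, limit -/

namespace Vilenkin

section BlockMartingale

/-- The coefficient sequence that is equal to `c_k` on the block `[M_k, M_{k+1})` and to `0`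
at `0`. -/
noncomputable def blockCoeff (m : ℕ → ℕ) (c : ℕ → ℝ) (i : ℕ) : ℂ :=
  if i = 0 then 0 else (c (Nat.findGreatest (fun k => M m k ≤ i) i) : ℂ)

theorem seriesMartingale_zero {m : ℕ → ℕ} (c : ℕ → ℝ) (x : Group m) :
    seriesMartingale m (blockCoeff m c) 0 x = 0 := by
  simp [seriesMartingale, seriesSum, M, blockCoeff]

variable {m : ℕ → ℕ} [∀ k, NeZero (m k)]

theorem blockCoeff_eq (hm : ∀ k, 2 ≤ m k) (c : ℕ → ℝ) {i k : ℕ} (h : M m k ≤ i)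
    (h' : i < M m (k + 1)) : blockCoeff m c i = c k := by
  have h0 : i ≠ 0 := ((M_pos k).trans_le h).ne'
  -- The search bound `i` in `blockCoeff` loses nothing, because `k < M_k ≤ i`.
  have hk : k ≤ i := (lt_M hm k).le.trans h
  have hle : k ≤ Nat.findGreatest (fun k => M m k ≤ i) i := Nat.le_findGreatest hk h
  have hspec : M m (Nat.findGreatest (fun k => M m k ≤ i) i) ≤ i :=
    Nat.findGreatest_spec (P := fun k => M m k ≤ i) hk h
  have hge : Nat.findGreatest (fun k => M m k ≤ i) i ≤ k := by
    by_contra! hlt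
    exact absurd (hspec.trans_lt h') (not_lt.2 (M_mono hlt))
  rw [blockCoeff, if_neg h0, le_antisymm hge hle]

theorem seriesMartingale_succ (hm : ∀ k, 2 ≤ m k) (c : ℕ → ℝ) (n : ℕ) (x : Group m) :
    seriesMartingale m (blockCoeff m c) (n + 1) x = seriesMartingale m (blockCoeff m c) n x +
      c n * (dirichletKernel m (M m (n + 1)) x - dirichletKernel m (M m n) x) := by
  have h := M_mono (m := m) n.le_succ
  rw [seriesMartingale, seriesSum, ← Finset.sum_range_add_sum_Ico _ h, dirichletKernel,
    dirichletKernel, ← Finset.sum_Ico_eq_sub _ h, Finset.mul_sum]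
  refine congrArg₂ _ rfl (Finset.sum_congr rfl fun i hi => ?_)
  rw [blockCoeff_eq hm c (Finset.mem_Ico.1 hi).1 (Finset.mem_Ico.1 hi).2]

/-- Both kernels vanish off `I_n(0)`; on it the difference is `M_{n+1} - M_n` or `-M_n`. -/
theorem norm_dirichletKernel_sub_le (hm : ∀ k, 2 ≤ m k) (n : ℕ) (x : Group m) :
    ‖dirichletKernel m (M m (n + 1)) x - dirichletKernel m (M m n) x‖ ≤
      {x : Group m | ∀ k < n, x k = 0}.indicator (fun _ => (M m (n + 1) : ℝ)) x := by
  have hle : (M m n : ℝ) ≤ M m (n + 1) := Nat.cast_le.2 (M_mono n.le_succ)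
  rw [dirichletKernel_M hm, dirichletKernel_M hm]
  simp only [Nat.forall_lt_succ_right]
  by_cases h : ∀ k < n, x k = 0
  · rw [Set.indicator_of_mem (show x ∈ {x : Group m | ∀ k < n, x k = 0} from h)]
    by_cases h' : x n = 0
    · rw [if_pos ⟨h, h'⟩, if_pos h, ← Complex.ofReal_natCast, ← Complex.ofReal_natCast,
        ← Complex.ofReal_sub, Complex.norm_real, Real.norm_eq_abs, abs_of_nonneg (by linarith)]
      linarith [(Nat.cast_nonneg (M m n) : (0 : ℝ) ≤ _)]
    · rw [if_neg fun h => h' h.2, if_pos h, zero_sub, norm_neg, Complex.norm_natCast]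
      exact hle
  · rw [Set.indicator_of_notMem (show x ∉ {x : Group m | ∀ k < n, x k = 0} from h),
      if_neg fun h' => h h'.1, if_neg h, sub_self, norm_zero]

theorem enorm_seriesMartingale_sub_le (hm : ∀ k, 2 ≤ m k) (c : ℕ → ℝ) (N j : ℕ) (x : Group m) :
    ‖seriesMartingale m (blockCoeff m c) (N + j) x - seriesMartingale m (blockCoeff m c) N x‖ₑ ≤
      ∑ i ∈ Finset.range j, {x : Group m | ∀ k < N + i, x k = 0}.indicator
        (fun _ => ENNReal.ofReal (|c (N + i)| * M m (N + i + 1))) x := by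
  induction j with
  | zero => simp
  | succ j ih =>
    rw [← add_assoc, seriesMartingale_succ hm, add_sub_right_comm, Finset.sum_range_succ]
    refine (enorm_add_le _ _).trans (add_le_add ih ?_)
    rw [← ofReal_norm, norm_mul, Complex.norm_real, Real.norm_eq_abs]
    have h := mul_le_mul_of_nonneg_left (norm_dirichletKernel_sub_le hm (N + j) x)
      (abs_nonneg (c (N + j)))
    refine (ENNReal.ofReal_le_ofReal h).trans (le_of_eq ?_)
    by_cases hx : x ∈ {x : Group m | ∀ k < N + j, x k = 0}
    · rw [Set.indicator_of_mem hx, Set.indicator_of_mem hx]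
    · rw [Set.indicator_of_notMem hx, Set.indicator_of_notMem hx, mul_zero, ENNReal.ofReal_zero]

theorem _root_.ENNReal.sum_rpow_le_of_le_one {ι : Type*} (s : Finset ι) (f : ι → ℝ≥0∞) {p : ℝ}
    (hp : 0 < p) (hp1 : p ≤ 1) : (∑ i ∈ s, f i) ^ p ≤ ∑ i ∈ s, f i ^ p := by
  classical
  induction s using Finset.induction_on with
  | empty => simp [hp]
  | insert i s hi ih =>
    rw [Finset.sum_insert hi, Finset.sum_insert hi]
    exact (ENNReal.rpow_add_le_add_rpow _ _ hp.le hp1).trans (add_le_add le_rfl ih)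

theorem eLpNorm_ofReal {α E : Type*} [MeasurableSpace α] [ENorm E] {p : ℝ} (hp : 0 < p) (g : α → E)
    (μ : Measure α) :
    eLpNorm g (ENNReal.ofReal p) μ = (∫⁻ x, ‖g x‖ₑ ^ p ∂μ) ^ (1 / p) := by
  rw [eLpNorm_eq_lintegral_rpow_enorm_toReal (by simpa using hp) ENNReal.ofReal_ne_top,
    ENNReal.toReal_ofReal hp.le]

/-- A bound of the Hardy quasi-norm of a martingale that starts at the index `N` and whose
differences live on the intervals `I_{N+i}(0)`. -/
theorem hardyNorm_le {p : ℝ} (hp : 0 < p) (hp1 : p ≤ 1) {f : ℕ → Group m → ℂ} {N : ℕ}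
    {b : ℕ → ℝ≥0∞} {T : ℝ≥0∞}
    (hf : ∀ k x, ∃ j, ‖f k x‖ₑ ≤ ∑ i ∈ Finset.range j,
      {x : Group m | ∀ k < N + i, x k = 0}.indicator (fun _ => b i) x)
    (hT : ∑' i, b i ^ p * (M m (N + i) : ℝ≥0∞)⁻¹ ≤ T) :
    hardyNorm m p f ≤ T ^ (1 / p) := by
  have hms : ∀ n, MeasurableSet {x : Group m | ∀ k < n, x k = 0} := fun n =>
    measurableSet_interval m n 0
  rw [hardyNorm, eLpNorm_ofReal hp]
  refine ENNReal.rpow_le_rpow (le_trans ?_ hT) (by positivity)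
  calc ∫⁻ x, ‖⨆ k, ‖f k x‖ₑ‖ₑ ^ p ∂(haar m)
      ≤ ∫⁻ x, ∑' i, {x : Group m | ∀ k < N + i, x k = 0}.indicator (fun _ => b i ^ p) x
          ∂(haar m) := by
        refine lintegral_mono fun x => ?_
        simp only [enorm_eq_self]
        rw [← ENNReal.le_rpow_inv_iff hp]
        -- Since `p ≤ 1`, the `p`-th power is subadditive, and every member of the martingale is
        -- bounded by the same full series.
        refine iSup_le fun k => ?_
        rw [ENNReal.le_rpow_inv_iff hp]
        obtain ⟨j, hj⟩ := hf k x
        refine (ENNReal.rpow_le_rpow hj hp.le).trans ?_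
        refine (ENNReal.sum_rpow_le_of_le_one _ _ hp hp1).trans ?_
        refine le_trans (Finset.sum_le_sum fun i _ => le_of_eq ?_)
          (ENNReal.sum_le_tsum (Finset.range j))
        by_cases hx : x ∈ {x : Group m | ∀ k < N + i, x k = 0} <;> simp [hx, hp]
    _ = ∑' i, b i ^ p * (M m (N + i) : ℝ≥0∞)⁻¹ := by
        rw [lintegral_tsum fun i => (measurable_const.indicator (hms (N + i))).aemeasurable]
        refine tsum_congr fun i => ?_
        rw [lintegral_indicator_const (hms _), haar_forall_eq_zero]

/-- The modulus of continuity of a block martingale is bounded by the tails of a series. -/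
theorem modulus_seriesMartingale_le (hm : ∀ k, 2 ≤ m k) {p : ℝ} (hp : 0 < p) (hp1 : p ≤ 1)
    (c : ℕ → ℝ) (N : ℕ) {T : ℝ≥0∞}
    (hT : ∑' i, ENNReal.ofReal (|c (N + i)| * M m (N + i + 1)) ^ p *
      (M m (N + i) : ℝ≥0∞)⁻¹ ≤ T) :
    modulus m p (seriesMartingale m (blockCoeff m c)) N ≤ T ^ (1 / p) := by
  refine hardyNorm_le hp hp1 (fun k x => ?_) hT
  rw [partialSumFun_seriesMartingale hm]
  -- The martingale `f - S_{M_N} f` vanishes up to time `N` and afterwards collects the later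
  -- increments.
  rcases le_total k N with h | h
  · exact ⟨0, by simp [min_eq_right h]⟩
  · obtain ⟨j, rfl⟩ := Nat.exists_eq_add_of_le h
    rw [min_eq_left h]
    exact ⟨j, enorm_seriesMartingale_sub_le hm c N j x⟩

theorem memHardy_seriesMartingale (hm : ∀ k, 2 ≤ m k) {p : ℝ} (hp : 0 < p) (hp1 : p ≤ 1)
    (c : ℕ → ℝ) {T : ℝ≥0∞} (hTfin : T ≠ ∞)
    (hT : ∑' i, ENNReal.ofReal (|c i| * M m (i + 1)) ^ p * (M m i : ℝ≥0∞)⁻¹ ≤ T) :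
    MemHardy m p (seriesMartingale m (blockCoeff m c)) := by
  refine ⟨martingale_seriesMartingale hm _, lt_of_le_of_lt (b := T ^ (1 / p)) ?_
    (ENNReal.rpow_lt_top_of_nonneg (by positivity) hTfin)⟩
  refine hardyNorm_le (N := 0) (b := fun i => ENNReal.ofReal (|c i| * M m (i + 1))) hp hp1
    (fun k x => ⟨k, ?_⟩) (by simpa using hT)
  have h := enorm_seriesMartingale_sub_le hm c 0 k x
  simpa only [zero_add, seriesMartingale_zero, sub_zero] using h

/-- Past the first nonzero coordinate of `x` all the Dirichlet kernels in the increments vanish, and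
almost every `x` has such a coordinate. -/
theorem exists_isLimitFunction (hm : ∀ k, 2 ≤ m k) (c : ℕ → ℝ) :
    ∃ g, IsLimitFunction m (seriesMartingale m (blockCoeff m c)) g := by
  refine measurable_limit_of_tendsto_metrizable_ae
    (fun n => (measurable_seriesMartingale hm _ n).aemeasurable) ?_
  filter_upwards [ae_exists_ne_zero hm] with x ⟨s, hs⟩
  have hD : ∀ n, s < n → dirichletKernel m (M m n) x = 0 := fun n hn => by
    rw [dirichletKernel_M hm, if_neg fun h => hs (h s hn)]
  refine ⟨seriesMartingale m (blockCoeff m c) (s + 1) x, tendsto_const_nhds.congr' ?_⟩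
  filter_upwards [eventually_ge_atTop (s + 1)] with n hn
  induction n, hn using Nat.le_induction with
  | base => rfl
  | succ n hn ih =>
    rw [seriesMartingale_succ hm c n, hD n hn, hD (n + 1) (by omega), sub_zero, mul_zero,
      add_zero, ih]

end BlockMartingale

end Vilenkin

/-! ### The counterexample for `p < 1/2` -/

namespace Vilenkin

variable {m : ℕ → ℕ} [∀ k, NeZero (m k)]

theorem measurable_fejer (hm : ∀ k, 2 ≤ m k) (f : ℕ → Group m → ℂ) (n : ℕ) :
    Measurable (fejer m f n) := by
  unfold fejer partialSum
  exact (Finset.measurable_sum _ fun k _ => Finset.measurable_sum _ fun i _ =>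
    (measurable_psi hm i).const_mul _).const_mul _

section Linear

/-- Each term is at most `B^p M_{N+i}^{2p-1}`. The exponent is negative and `M_{N+i} ≥ 2^i M_N`, so
a geometric series of ratio `2^{2p-1}` dominates. -/
theorem tsum_M_rpow_le (hm : ∀ k, 2 ≤ m k) {B : ℕ} (hB : ∀ k, m k ≤ B) {p : ℝ} (hp : 0 < p)
    (hp2 : p < 1 / 2) (N : ℕ) :
    ∑' i, ENNReal.ofReal (|(M m (N + i) : ℝ)| * M m (N + i + 1)) ^ p *
      (M m (N + i) : ℝ≥0∞)⁻¹ ≤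
      ENNReal.ofReal ((B : ℝ) ^ p * (1 - 2 ^ (2 * p - 1))⁻¹ * (M m N : ℝ) ^ (2 * p - 1)) := by
  set r : ℝ := 2 ^ (2 * p - 1) with hr
  have hr0 : 0 ≤ r := by positivity
  have hr1 : r < 1 := Real.rpow_lt_one_of_one_lt_of_neg one_lt_two (by linarith)
  have hMpos : ∀ k, (0 : ℝ) < M m k := fun k => Nat.cast_pos.2 (M_pos k)
  have hterm : ∀ i, ENNReal.ofReal (|(M m (N + i) : ℝ)| * M m (N + i + 1)) ^ p *
      (M m (N + i) : ℝ≥0∞)⁻¹ ≤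
      ENNReal.ofReal ((B : ℝ) ^ p * (M m N : ℝ) ^ (2 * p - 1) * r ^ i) := by
    intro i
    have hM := hMpos (N + i)
    have hM' := hMpos (N + i + 1)
    rw [ENNReal.ofReal_rpow_of_nonneg (by positivity) hp.le, ← ENNReal.ofReal_natCast,
      ← ENNReal.ofReal_inv_of_pos hM, ← ENNReal.ofReal_mul (by positivity), abs_of_pos hM]
    refine ENNReal.ofReal_le_ofReal ?_
    have h1 : (M m (N + i) : ℝ) * M m (N + i + 1) ≤ B * (M m (N + i) : ℝ) ^ (2 : ℝ) := by
      have : (M m (N + i + 1) : ℝ) ≤ B * M m (N + i) := by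
        exact_mod_cast Nat.mul_le_mul_right _ (hB _)
      rw [Real.rpow_two]
      nlinarith
    have h2 : (2 : ℝ) ^ i * M m N ≤ M m (N + i) := by exact_mod_cast two_pow_mul_M_le hm N i
    calc ((M m (N + i) : ℝ) * M m (N + i + 1)) ^ p * (M m (N + i) : ℝ)⁻¹
        ≤ (B * (M m (N + i) : ℝ) ^ (2 : ℝ)) ^ p * (M m (N + i) : ℝ)⁻¹ := by gcongr
      _ = (B : ℝ) ^ p * (M m (N + i) : ℝ) ^ (2 * p - 1) := by
          rw [Real.mul_rpow (by positivity) (by positivity), ← Real.rpow_mul hM.le,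
            Real.rpow_sub_one hM.ne', div_eq_mul_inv, mul_assoc]
      _ ≤ (B : ℝ) ^ p * ((2 : ℝ) ^ i * M m N) ^ (2 * p - 1) := by
          refine mul_le_mul_of_nonneg_left ?_ (by positivity)
          exact Real.rpow_le_rpow_of_nonpos (mul_pos (by positivity) (hMpos N)) h2 (by linarith)
      _ = (B : ℝ) ^ p * (M m N : ℝ) ^ (2 * p - 1) * r ^ i := by
          rw [Real.mul_rpow (by positivity) (by positivity), hr, ← Real.rpow_natCast,
            ← Real.rpow_natCast, ← Real.rpow_mul two_pos.le, ← Real.rpow_mul two_pos.le,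
            mul_comm (i : ℝ)]
          ring
  refine (ENNReal.tsum_le_tsum hterm).trans (le_of_eq ?_)
  rw [← ENNReal.ofReal_tsum_of_nonneg (fun i => by positivity)
    ((summable_geometric_of_lt_one hr0 hr1).mul_left _), tsum_mul_left,
    tsum_geometric_of_lt_one hr0 hr1]
  congr 1
  ring

theorem ofReal_mul_haar_le_weakNorm {p t : ℝ} (ht : 0 < t) (g : Group m → ℂ) :
    ENNReal.ofReal (t ^ p) * haar m {x | t < ‖g x‖} ≤ weakNorm m p g :=
  le_iSup₂ (f := fun (t : ℝ) (_ : 0 < t) => ENNReal.ofReal (t ^ p) * haar m {x | t < ‖g x‖}) t ht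

/-- If the `n`-th coefficient of a Vilenkin series is at least `n` in modulus, then the
deviations of three consecutive Fejér means from any function cannot all be small in `L_{p,∞}`. -/
theorem le_weakNorm_fejer_add (hm : ∀ k, 2 ≤ m k) (a : ℕ → ℂ) (p : ℝ) {n : ℕ}
    (hn : ((n + 1 : ℕ) : ℝ) ≤ ‖a (n + 1)‖) (g : Group m → ℂ) :
    ENNReal.ofReal ((1 / 6) ^ p) ≤
      weakNorm m p (fun x => fejer m (seriesMartingale m a) (n + 1 + 1) x - g x) +
        weakNorm m p (fun x => fejer m (seriesMartingale m a) (n + 1) x - g x) +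
        weakNorm m p (fun x => fejer m (seriesMartingale m a) n x - g x) := by
  set h : ℕ → Group m → ℂ := fun n x => fejer m (seriesMartingale m a) n x - g x with hh
  have key : ∀ x, 1 ≤ 2 * ‖h (n + 1 + 1) x‖ + 2 * ‖h (n + 1) x‖ + ‖h n x‖ := by
    intro x
    -- With step 1 the vanishing hypothesis is empty and a single term of the series remains.
    have h1 := fejerSum_second_difference m a (n := n) (q := 1) (fun i _ _ => by omega) x
    simp only [Finset.range_one, Finset.sum_singleton, Nat.cast_one, Nat.cast_zero, sub_zero,
      one_mul, add_zero, ← natCast_mul_fejer hm] at h1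
    -- The function `g` cancels because `(n + 2) - 2 (n + 1) + n = 0`.
    have h2 : a (n + 1) * psi m (n + 1) x = ((n + 1 + 1 : ℕ) : ℂ) * h (n + 1 + 1) x -
        2 * (((n + 1 : ℕ) : ℂ) * h (n + 1) x) + (n : ℂ) * h n x := by
      rw [← h1]; simp only [hh]; push_cast; ring
    have h3 : ‖a (n + 1)‖ ≤ (n + 1 + 1 : ℕ) * ‖h (n + 1 + 1) x‖ +
        2 * ((n + 1 : ℕ) * ‖h (n + 1) x‖) + n * ‖h n x‖ := by
      calc ‖a (n + 1)‖ = ‖a (n + 1) * psi m (n + 1) x‖ := by rw [norm_mul, norm_psi hm, mul_one]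
        _ ≤ _ := by
          rw [h2]
          refine (norm_add_le _ _).trans (add_le_add ((norm_sub_le _ _).trans ?_) ?_)
          · simp only [norm_mul, Complex.norm_natCast, Complex.norm_ofNat]; rfl
          · rw [norm_mul, Complex.norm_natCast]
    have h4 := hn.trans h3
    push_cast at h4
    have hn0 : (0 : ℝ) ≤ n := n.cast_nonneg
    by_contra! hcon
    have p1 := norm_nonneg (h (n + 1 + 1) x)
    have p2 := norm_nonneg (h n x)
    have h5 := mul_lt_mul_of_pos_left hcon (by linarith : (0 : ℝ) < n + 1)
    nlinarith [mul_nonneg hn0 p1]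
  -- If all three deviations were at most `1/6`, the bound `key` would give `1 ≤ 5/6`.
  have hcover : (Set.univ : Set (Group m)) ⊆ {x | 1 / 6 < ‖h (n + 1 + 1) x‖} ∪
      {x | 1 / 6 < ‖h (n + 1) x‖} ∪ {x | 1 / 6 < ‖h n x‖} := by
    intro x _
    by_contra hx
    simp only [Set.mem_union, Set.mem_ofPred_eq, not_or, not_lt] at hx
    linarith [key x, hx.1.1, hx.1.2, hx.2]
  have hmeas : (1 : ℝ≥0∞) ≤ haar m {x | 1 / 6 < ‖h (n + 1 + 1) x‖} +
      haar m {x | 1 / 6 < ‖h (n + 1) x‖} + haar m {x | 1 / 6 < ‖h n x‖} := by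
    rw [← measure_univ (μ := haar m)]
    exact (measure_mono hcover).trans ((measure_union_le _ _).trans
      (add_le_add (measure_union_le _ _) le_rfl))
  have h6 : (0 : ℝ) < 1 / 6 := by norm_num
  calc ENNReal.ofReal ((1 / 6) ^ p) = ENNReal.ofReal ((1 / 6) ^ p) * 1 := (mul_one _).symm
    _ ≤ _ := (mul_le_mul_right hmeas _)
    _ ≤ _ := by
      rw [mul_add, mul_add]
      exact add_le_add (add_le_add (ofReal_mul_haar_le_weakNorm h6 _)
        (ofReal_mul_haar_le_weakNorm h6 _)) (ofReal_mul_haar_le_weakNorm h6 _)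

theorem not_tendsto_weakNorm (hm : ∀ k, 2 ≤ m k) (p : ℝ) (g : Group m → ℂ) :
    ¬ Tendsto (fun n : ℕ => weakNorm m p fun x =>
      fejer m (seriesMartingale m (blockCoeff m fun k => M m k)) n x - g x) atTop (𝓝 0) := by
  intro hlim
  -- The shift makes `n + 1 = M_k`, the left end of a block, where the coefficient equals its index.
  have hseq : Tendsto (fun k => M m k - 1) atTop atTop :=
    tendsto_atTop_mono (fun k => Nat.le_sub_one_of_lt (lt_M hm k)) tendsto_id
  have h1 := (hlim.comp ((tendsto_add_atTop_nat 1).comp ((tendsto_add_atTop_nat 1).comp hseq)))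
  have h2 := hlim.comp ((tendsto_add_atTop_nat 1).comp hseq)
  have h3 := (h1.add h2).add (hlim.comp hseq)
  simp only [add_zero] at h3
  refine absurd (ge_of_tendsto' h3 fun k => le_weakNorm_fejer_add hm _ p ?_ g) ?_
  · rw [Nat.sub_add_cancel (M_pos k), blockCoeff_eq hm _ le_rfl
      ((Nat.lt_mul_iff_one_lt_left (M_pos k)).2 (hm k)), Complex.norm_real, Real.norm_natCast]
  · exact not_le.2 (ENNReal.ofReal_pos.2 (by positivity))

theorem exists_martingale_of_lt_half (hm : ∀ k, 2 ≤ m k) {B : ℕ} (hB : ∀ k, m k ≤ B) {p : ℝ}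
    (hp : 0 < p) (hp2 : p < 1 / 2) :
    ∃ f : ℕ → Group m → ℂ, MemHardy m p f ∧
      (∃ C : ℝ, ∀ᶠ N : ℕ in atTop,
        modulus m p f N ≤ ENNReal.ofReal (C * (1 / (M m N : ℝ) ^ (1 / p - 2)))) ∧
      ∃ g : Group m → ℂ, IsLimitFunction m f g ∧
        ¬ Tendsto (fun n : ℕ => weakNorm m p fun x => fejer m f n x - g x) atTop (𝓝 0) := by
  have hp1 : p ≤ 1 := by linarith
  obtain ⟨g, hg⟩ := exists_isLimitFunction hm fun k => (M m k : ℝ)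
  refine ⟨seriesMartingale m (blockCoeff m fun k => (M m k : ℝ)), ?_,
    ⟨((B : ℝ) ^ p * (1 - 2 ^ (2 * p - 1))⁻¹) ^ (1 / p), ?_⟩, g, hg,
    not_tendsto_weakNorm hm p g⟩
  · have h := tsum_M_rpow_le hm hB hp hp2 0
    simp only [zero_add] at h
    exact memHardy_seriesMartingale hm hp hp1 (fun k => (M m k : ℝ)) ENNReal.ofReal_ne_top h
  · refine Eventually.of_forall fun N => ?_
    have h := modulus_seriesMartingale_le hm hp hp1 (fun k => (M m k : ℝ)) N
      (tsum_M_rpow_le hm hB hp hp2 N)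
    refine h.trans (le_of_eq ?_)
    have hr1 : (2 : ℝ) ^ (2 * p - 1) < 1 :=
      Real.rpow_lt_one_of_one_lt_of_neg one_lt_two (by linarith)
    have hK : 0 ≤ (B : ℝ) ^ p * (1 - 2 ^ (2 * p - 1))⁻¹ :=
      mul_nonneg (by positivity) (inv_nonneg.2 (by linarith))
    have hM : (0 : ℝ) ≤ M m N := Nat.cast_nonneg _
    rw [ENNReal.ofReal_rpow_of_nonneg (mul_nonneg hK (by positivity)) (by positivity),
      Real.mul_rpow hK (by positivity), ← Real.rpow_mul hM, one_div ((M m N : ℝ) ^ _),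
      ← Real.rpow_neg hM]
    -- The exponents agree: `(2p - 1) / p = -(1/p - 2)`.
    congr 3
    field_simp
    ring

end Linear

end Vilenkin

/-! ### The case `p = 1/2`: Fejér kernels of sparse index and sparse coefficients -/

namespace Vilenkin

section Sparse

/-- The integers `∑_{j < J} M_{3j}`. -/
def sparseIndex (m : ℕ → ℕ) (J : ℕ) : ℕ := ∑ j ∈ Finset.range J, M m (3 * j)

theorem sparseIndex_succ (m : ℕ → ℕ) (J : ℕ) :
    sparseIndex m (J + 1) = sparseIndex m J + M m (3 * J) := Finset.sum_range_succ _ _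

theorem pairwiseDisjoint_leadingSet (m : ℕ → ℕ) (J : ℕ) :
    Set.PairwiseDisjoint (Finset.range J : Set ℕ) fun j => leadingSet m (3 * j + 1) := by
  intro i _ j _ hij
  refine Set.disjoint_left.2 fun x hi hj => ?_
  rcases lt_or_gt_of_ne hij with h | h
  · exact hi.2.1 (hj.1 _ (by omega))
  · exact hj.2.1 (hi.1 _ (by omega))

variable {m : ℕ → ℕ} [∀ k, NeZero (m k)]

/-- Thus every `ψ_i` with `i < sparseIndex m (J + 1)` equals `1` on `leadingSet m (3 * J + 1)`. -/
theorem sparseIndex_succ_le (hm : ∀ k, 2 ≤ m k) (J : ℕ) :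
    sparseIndex m (J + 1) ≤ M m (3 * J + 1) := by
  have h : sparseIndex m J ≤ M m (3 * J) := by
    induction J with
    | zero => simp [sparseIndex]
    | succ J ih =>
      calc sparseIndex m (J + 1) ≤ 2 * M m (3 * J) := by rw [sparseIndex_succ]; omega
        _ ≤ M m (3 * J + 1) := two_mul_M_le hm _
        _ ≤ M m (3 * (J + 1)) := M_mono (by omega)
  calc sparseIndex m (J + 1) ≤ 2 * M m (3 * J) := by rw [sparseIndex_succ]; omega
    _ ≤ M m (3 * J + 1) := two_mul_M_le hm _

/-- The gap 3 between the exponents makes all later summands multiples of `M_{3j+3}`, the block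
length that drops out on `leadingSet m (3 * j + 1)`. -/
theorem exists_sparseIndex_eq (m : ℕ → ℕ) {j J : ℕ} (h : j + 1 ≤ J) :
    ∃ c, sparseIndex m J = sparseIndex m (j + 1) + c * M m (3 * j + 3) := by
  induction J, h using Nat.le_induction with
  | base => exact ⟨0, by simp⟩
  | succ J hJ ih =>
    obtain ⟨c, hc⟩ := ih
    obtain ⟨d, hd⟩ := M_dvd (m := m) (show 3 * j + 3 ≤ 3 * J by omega)
    exact ⟨c + d, by rw [sparseIndex_succ, hc, hd]; ring⟩

/-- After the full blocks drop out, the kernel has modulus `r (r + 1) / 2` with `r = sparseIndex m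
(j + 1)`, and `r ≥ M_{3j} ≥ M_{3j+1} / B`. -/
theorem le_norm_fejerKernel_sparseIndex (hm : ∀ k, 2 ≤ m k) {B : ℕ} (hB : ∀ k, m k ≤ B)
    {j J : ℕ} (h : j < J) {x : Group m} (hx : x ∈ leadingSet m (3 * j + 1)) :
    (M m (3 * j + 1) / (2 * B) : ℝ) ^ 2 ≤ ‖fejerKernel m (sparseIndex m J) x‖ := by
  obtain ⟨c, hc⟩ := exists_sparseIndex_eq m h
  have hr := sparseIndex_succ_le hm j
  have hr' : sparseIndex m (j + 1) ≤ M m (3 * j + 1 + 2) := hr.trans (M_mono (by omega))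
  rw [hc, fejerKernel_add_mul_M hm hx.2.1 hx.2.2 hr', norm_mul, norm_psi hm, one_mul,
    fejerKernel_of_eq_zero hr hx.1]
  have h1 : M m (3 * j + 1) ≤ B * sparseIndex m (j + 1) :=
    calc M m (3 * j + 1) ≤ B * M m (3 * j) := Nat.mul_le_mul_right _ (hB _)
      _ ≤ B * sparseIndex m (j + 1) := by
        rw [sparseIndex_succ]; exact Nat.mul_le_mul_left _ (Nat.le_add_left _ _)
  have hB0 : (0 : ℝ) < B := Nat.cast_pos.2 ((NeZero.pos _).trans_le (hB 0))
  set r := sparseIndex m (j + 1)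
  have h2 : (M m (3 * j + 1) : ℝ) ≤ B * r := by exact_mod_cast h1
  have h3 : ‖(r : ℂ) * (r + 1) / 2‖ = (r : ℝ) * (r + 1) / 2 := by
    rw [show (r : ℂ) * (r + 1) / 2 = (((r : ℝ) * (r + 1) / 2 : ℝ) : ℂ) by push_cast; ring,
      Complex.norm_real, Real.norm_of_nonneg (by positivity)]
  have h4 : (M m (3 * j + 1) / (2 * B) : ℝ) ≤ r / 2 := by
    rw [div_le_div_iff₀ (by positivity) two_pos]
    linarith
  rw [h3]
  calc (M m (3 * j + 1) / (2 * B) : ℝ) ^ 2 ≤ ((r : ℝ) / 2) ^ 2 := by gcongr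
    _ ≤ (r : ℝ) * (r + 1) / 2 := by nlinarith [(Nat.cast_nonneg r : (0 : ℝ) ≤ r)]

theorem measurable_fejerKernel (hm : ∀ k, 2 ≤ m k) (n : ℕ) : Measurable (fejerKernel m n) := by
  unfold fejerKernel
  exact Finset.measurable_sum _ fun i _ => (measurable_psi hm i).const_mul _

/-- The integral of the square root of `q |K_q|` for `q = ∑_{j < J} M_{3j}` grows linearly
in `J`. -/
theorem le_lintegral_fejerKernel_sparseIndex (hm : ∀ k, 2 ≤ m k) {B : ℕ} (hB : ∀ k, m k ≤ B)
    (J : ℕ) :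
    ENNReal.ofReal (J / (8 * B)) ≤
      ∫⁻ x, ‖fejerKernel m (sparseIndex m J) x‖ₑ ^ (1 / 2 : ℝ) ∂(haar m) := by
  have hB0 : (0 : ℝ) < B := Nat.cast_pos.2 ((NeZero.pos _).trans_le (hB 0))
  -- The root of the lower bound is `M / (2B)` on a set of measure at least `1 / (4M)`: every `j`
  -- contributes the same `1 / (8B)`.
  have hpiece : ∀ j ∈ Finset.range J, ENNReal.ofReal (1 / (8 * B)) ≤
      ∫⁻ x in leadingSet m (3 * j + 1),
        ‖fejerKernel m (sparseIndex m J) x‖ₑ ^ (1 / 2 : ℝ) ∂(haar m) := by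
    intro j hj
    have hM : (0 : ℝ) < M m (3 * j + 1) := Nat.cast_pos.2 (M_pos _)
    calc ENNReal.ofReal (1 / (8 * B))
        = ENNReal.ofReal (M m (3 * j + 1) / (2 * B)) *
            ((M m (3 * j + 1) : ℝ≥0∞)⁻¹ * (2⁻¹ * 2⁻¹)) := by
          rw [← ENNReal.ofReal_natCast, ← ENNReal.ofReal_inv_of_pos hM,
            ← ENNReal.ofReal_ofNat 2, ← ENNReal.ofReal_inv_of_pos two_pos,
            ← ENNReal.ofReal_mul (by positivity), ← ENNReal.ofReal_mul (by positivity),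
            ← ENNReal.ofReal_mul (by positivity)]
          congr 1
          field_simp
          norm_num
      _ ≤ ENNReal.ofReal (M m (3 * j + 1) / (2 * B)) * haar m (leadingSet m (3 * j + 1)) :=
          mul_le_mul_right (le_haar_leadingSet hm _) _
      _ = ∫⁻ _ in leadingSet m (3 * j + 1),
            ENNReal.ofReal (M m (3 * j + 1) / (2 * B)) ∂(haar m) := (setLIntegral_const _ _).symm
      _ ≤ _ := by
          refine setLIntegral_mono' (measurableSet_leadingSet _) fun x hx => ?_
          have h := le_norm_fejerKernel_sparseIndex hm hB (Finset.mem_range.1 hj) hx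
          rw [← ofReal_norm, ENNReal.ofReal_rpow_of_nonneg (norm_nonneg _) (by norm_num),
            ← Real.sqrt_eq_rpow]
          exact ENNReal.ofReal_le_ofReal (Real.le_sqrt_of_sq_le h)
  calc ENNReal.ofReal (J / (8 * B))
      = ∑ _j ∈ Finset.range J, ENNReal.ofReal (1 / (8 * B)) := by
        rw [Finset.sum_const, Finset.card_range, nsmul_eq_mul, ← ENNReal.ofReal_natCast,
          ← ENNReal.ofReal_mul (Nat.cast_nonneg _), mul_one_div]
    _ ≤ ∑ j ∈ Finset.range J, ∫⁻ x in leadingSet m (3 * j + 1),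
          ‖fejerKernel m (sparseIndex m J) x‖ₑ ^ (1 / 2 : ℝ) ∂(haar m) := Finset.sum_le_sum hpiece
    _ = ∫⁻ x in ⋃ j ∈ Finset.range J, leadingSet m (3 * j + 1),
          ‖fejerKernel m (sparseIndex m J) x‖ₑ ^ (1 / 2 : ℝ) ∂(haar m) :=
        (lintegral_biUnion_finset (pairwiseDisjoint_leadingSet m J)
          (fun j _ => measurableSet_leadingSet _) _).symm
    _ ≤ _ := setLIntegral_le_lintegral _ _

open Classical in
/-- The block coefficients `M_k / k^2` for `k = 3 · 2^j`, and `0` for the other `k`. -/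
noncomputable def sparseCoeff (m : ℕ → ℕ) (k : ℕ) : ℝ :=
  if k ∈ Set.range (fun j : ℕ => 3 * 2 ^ j) then (M m k : ℝ) / (k : ℝ) ^ 2 else 0

/-- At `α = 3 · 2^k` the term is at most `B / α`, so the tail is a geometric series from the first
`α ≥ N`. -/
theorem tsum_sparseCoeff_le {B : ℕ} (hB : ∀ k, m k ≤ B) {N k₀ : ℕ} (h₀ : N ≤ 3 * 2 ^ k₀)
    (hlt : ∀ k < k₀, 3 * 2 ^ k < N) :
    ∑' i, ENNReal.ofReal (|sparseCoeff m (N + i)| * M m (N + i + 1)) ^ (1 / 2 : ℝ) *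
      (M m (N + i) : ℝ≥0∞)⁻¹ ≤ ENNReal.ofReal (2 * B / (3 * 2 ^ k₀)) := by
  have hmono : ∀ j, N ≤ 3 * 2 ^ (k₀ + j) := fun j =>
    h₀.trans (Nat.mul_le_mul_left _ (Nat.pow_le_pow_right two_pos (Nat.le_add_right _ _)))
  have hinj : Function.Injective fun j : ℕ => 3 * 2 ^ (k₀ + j) - N := by
    intro i j hij
    have h1 := hmono i
    have h2 := hmono j
    have h3 : 2 ^ (k₀ + i) = 2 ^ (k₀ + j) := by simp only at hij; omega
    exact Nat.add_left_cancel (Nat.pow_right_injective le_rfl h3)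
  -- Only indices with `N + i = 3 · 2^(k₀ + j)` contribute; the truncated subtraction is exact by
  -- `hmono`.
  rw [← hinj.tsum_eq]
  · have hterm : ∀ j, ENNReal.ofReal (|sparseCoeff m (N + (3 * 2 ^ (k₀ + j) - N))| *
        M m (N + (3 * 2 ^ (k₀ + j) - N) + 1)) ^ (1 / 2 : ℝ) *
        (M m (N + (3 * 2 ^ (k₀ + j) - N)) : ℝ≥0∞)⁻¹ ≤
        ENNReal.ofReal (B / (3 * 2 ^ k₀) * (1 / 2) ^ j) := by
      intro j
      rw [Nat.add_sub_cancel' (hmono j)]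
      set α := 3 * 2 ^ (k₀ + j) with hα
      have hM : (0 : ℝ) < M m α := Nat.cast_pos.2 (M_pos _)
      have hα0 : (0 : ℝ) < α := Nat.cast_pos.2 (by positivity)
      have hB1 : (1 : ℝ) ≤ B := Nat.one_le_cast.2 ((NeZero.pos _).trans_le (hB 0))
      have hM' : (M m (α + 1) : ℝ) ≤ B * M m α := by
        exact_mod_cast Nat.mul_le_mul_right _ (hB _)
      have hc : sparseCoeff m α = M m α / (α : ℝ) ^ 2 := if_pos ⟨k₀ + j, rfl⟩
      rw [ENNReal.ofReal_rpow_of_nonneg (by positivity) (by norm_num), ← ENNReal.ofReal_natCast,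
        ← ENNReal.ofReal_inv_of_pos hM, ← ENNReal.ofReal_mul (by positivity), hc,
        abs_of_nonneg (by positivity), ← Real.sqrt_eq_rpow]
      refine ENNReal.ofReal_le_ofReal ?_
      have hsq : √((M m α / (α : ℝ) ^ 2) * M m (α + 1)) ≤ B * M m α / α := by
        refine Real.sqrt_le_iff.2 ⟨by positivity, ?_⟩
        calc (M m α / (α : ℝ) ^ 2) * M m (α + 1)
            ≤ (M m α / (α : ℝ) ^ 2) * (B * M m α : ℝ) := by gcongr
          _ = (B : ℝ) * (M m α / α : ℝ) ^ 2 := by ring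
          _ ≤ (B : ℝ) ^ 2 * (M m α / α : ℝ) ^ 2 := by
            refine mul_le_mul_of_nonneg_right ?_ (by positivity)
            nlinarith
          _ = (B * M m α / α : ℝ) ^ 2 := by ring
      calc _ ≤ (B * M m α / α) * (M m α : ℝ)⁻¹ := by gcongr
        _ = B / (3 * 2 ^ k₀) * (1 / 2) ^ j := by
          have hα' : (α : ℝ) = 3 * 2 ^ k₀ * 2 ^ j := by rw [hα]; push_cast; ring
          rw [one_div, inv_pow, mul_div_right_comm, mul_assoc, mul_inv_cancel₀ hM.ne', mul_one, hα']
          field_simp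
    refine (ENNReal.tsum_le_tsum hterm).trans (le_of_eq ?_)
    rw [← ENNReal.ofReal_tsum_of_nonneg (fun i => by positivity)
      (summable_geometric_two.mul_left _), tsum_mul_left, tsum_geometric_two]
    congr 1
    ring
  · intro i hi
    have hmem : N + i ∈ Set.range (fun j : ℕ => 3 * 2 ^ j) := by
      by_contra hcon
      refine hi ?_
      simp only [sparseCoeff]
      rw [if_neg hcon]
      simp
    obtain ⟨k, hk⟩ := hmem
    simp only at hk
    have hk₀ : k₀ ≤ k := by
      by_contra! h
      have := hlt k h
      omega
    refine ⟨k - k₀, ?_⟩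
    simp only
    rw [Nat.add_sub_cancel' hk₀]
    omega

end Sparse

end Vilenkin

/-! ### The case `p = 1/2`: failure of convergence -/

namespace Vilenkin

variable {m : ℕ → ℕ} [∀ k, NeZero (m k)]

section Sparse

theorem sparseCoeff_three_mul_two_pow (m : ℕ → ℕ) (k : ℕ) :
    sparseCoeff m (3 * 2 ^ k) = M m (3 * 2 ^ k) / ((3 * 2 ^ k : ℕ) : ℝ) ^ 2 :=
  if_pos ⟨k, rfl⟩

/-- The index is not divisible by 3. Hence the block just below `M_α` is empty, as the second
difference at `M_α` requires. -/
theorem sparseCoeff_three_mul_two_pow_sub_one (m : ℕ → ℕ) (k : ℕ) :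
    sparseCoeff m (3 * 2 ^ k - 1) = 0 := by
  refine if_neg ?_
  rintro ⟨j, hj⟩
  have := Nat.two_pow_pos k
  simp only at hj
  omega

/-- This keeps `[M_α - q, M_α)` inside the block of order `α - 1`. -/
theorem sparseIndex_two_pow_add_le (hm : ∀ k, 2 ≤ m k) (k : ℕ) :
    M m (3 * 2 ^ k - 1) + sparseIndex m (2 ^ k) ≤ M m (3 * 2 ^ k) := by
  obtain ⟨J, hJ⟩ := Nat.exists_eq_succ_of_ne_zero (pow_ne_zero k two_ne_zero : 2 ^ k ≠ 0)
  rw [hJ, Nat.succ_eq_add_one, show 3 * (J + 1) - 1 = 3 * J + 2 by omega,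
    show 3 * (J + 1) = 3 * J + 2 + 1 by ring]
  have h1 := sparseIndex_succ_le hm J
  have h2 : M m (3 * J + 1) ≤ M m (3 * J + 2) := M_mono (by omega)
  have h3 := two_mul_M_le hm (3 * J + 2)
  omega

/-- The second difference of the Fejér sums of the sparse martingale at `M_α`, `α = 3 · 2^k`, is a
multiple of a Fejér kernel. -/
theorem fejerSum_sparse_second_difference (hm : ∀ k, 2 ≤ m k) (k : ℕ) (x : Group m) :
    fejerSum m (blockCoeff m (sparseCoeff m)) (M m (3 * 2 ^ k) + sparseIndex m (2 ^ k)) x -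
        2 * fejerSum m (blockCoeff m (sparseCoeff m)) (M m (3 * 2 ^ k)) x +
        fejerSum m (blockCoeff m (sparseCoeff m)) (M m (3 * 2 ^ k) - sparseIndex m (2 ^ k)) x =
      sparseCoeff m (3 * 2 ^ k) *
        (psi m (M m (3 * 2 ^ k)) x * fejerKernel m (sparseIndex m (2 ^ k)) x) := by
  have hle := sparseIndex_two_pow_add_le hm k
  have hα : 3 * 2 ^ k - 1 + 1 = 3 * 2 ^ k :=
    Nat.sub_add_cancel (Nat.mul_pos three_pos (Nat.two_pow_pos k))
  have hM := two_mul_M_le hm (3 * 2 ^ k)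
  have hpos := M_pos (m := m) (3 * 2 ^ k - 1)
  set N := M m (3 * 2 ^ k) with hN
  set q := sparseIndex m (2 ^ k)
  have hNq : N - q + q = N := Nat.sub_add_cancel (by omega)
  have h := fejerSum_second_difference m (blockCoeff m (sparseCoeff m)) (n := N - q) (q := q)
    (fun i hi _ => by
      rw [blockCoeff_eq hm _ (k := 3 * 2 ^ k - 1) (by omega) (by rw [hα]; omega),
        sparseCoeff_three_mul_two_pow_sub_one, Complex.ofReal_zero]) x
  rw [hNq] at h
  rw [h, fejerKernel, Finset.mul_sum, Finset.mul_sum]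
  refine Finset.sum_congr rfl fun i hi => ?_
  have hi' : i < N := (Finset.mem_range.1 hi).trans_le (by omega)
  have hpsi := psi_add_mul_M hm hi' 1 x
  rw [one_mul] at hpsi
  rw [blockCoeff_eq hm _ (k := 3 * 2 ^ k) (by omega) (by omega), add_comm N i, hpsi]
  ring

/-- The weights `N + q`, `-2N`, `N - q` cancel `g` and are at most `2N` in modulus. Division by `2N`
leaves `1 / (2α^2)`, weakened to a perfect square so that its root is simple. -/
theorem norm_fejerKernel_le_fejer_sparse (hm : ∀ k, 2 ≤ m k) (k : ℕ) (g : Group m → ℂ)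
    (x : Group m) :
    (1 / (2 * (3 * 2 ^ k : ℕ)) : ℝ) ^ 2 * ‖fejerKernel m (sparseIndex m (2 ^ k)) x‖ ≤
      ‖fejer m (seriesMartingale m (blockCoeff m (sparseCoeff m)))
          (M m (3 * 2 ^ k) + sparseIndex m (2 ^ k)) x - g x‖ +
        ‖fejer m (seriesMartingale m (blockCoeff m (sparseCoeff m))) (M m (3 * 2 ^ k)) x - g x‖ +
        ‖fejer m (seriesMartingale m (blockCoeff m (sparseCoeff m)))
          (M m (3 * 2 ^ k) - sparseIndex m (2 ^ k)) x - g x‖ := by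
  have h := fejerSum_sparse_second_difference hm k x
  have hle := sparseIndex_two_pow_add_le hm k
  have hc := sparseCoeff_three_mul_two_pow m k
  simp only [← natCast_mul_fejer hm] at h
  have hNpos : (0 : ℝ) < M m (3 * 2 ^ k) := Nat.cast_pos.2 (M_pos _)
  have hα : (0 : ℝ) < (3 * 2 ^ k : ℕ) := Nat.cast_pos.2 (by positivity)
  have hψ := norm_psi hm (M m (3 * 2 ^ k)) x
  set α := 3 * 2 ^ k
  set N := M m α
  set q := sparseIndex m (2 ^ k)
  have hq : q ≤ N := by omega
  set u := fejer m (seriesMartingale m (blockCoeff m (sparseCoeff m))) (N + q) x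
  set v := fejer m (seriesMartingale m (blockCoeff m (sparseCoeff m))) N x
  set w := fejer m (seriesMartingale m (blockCoeff m (sparseCoeff m))) (N - q) x
  have h1 : (sparseCoeff m α : ℂ) * (psi m N x * fejerKernel m q x) =
      ((N + q : ℕ) : ℂ) * (u - g x) - 2 * ((N : ℂ) * (v - g x)) +
        ((N - q : ℕ) : ℂ) * (w - g x) := by
    rw [← h, Nat.cast_sub hq]; push_cast; ring
  have h2 : sparseCoeff m α * ‖fejerKernel m q x‖ ≤
      (N + q : ℕ) * ‖u - g x‖ + 2 * (N * ‖v - g x‖) + (N - q : ℕ) * ‖w - g x‖ := by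
    have hc0 : 0 ≤ sparseCoeff m α := by rw [hc]; positivity
    have h3 := congrArg norm h1
    rw [norm_mul, norm_mul, hψ, one_mul, Complex.norm_real, Real.norm_of_nonneg hc0] at h3
    rw [h3]
    refine (norm_add_le _ _).trans (add_le_add ((norm_sub_le _ _).trans ?_) ?_)
    · simp only [norm_mul, Complex.norm_natCast, Complex.norm_ofNat]; rfl
    · rw [norm_mul, Complex.norm_natCast]
  have h4 : ((N + q : ℕ) : ℝ) ≤ 2 * N := by exact_mod_cast (by omega : N + q ≤ 2 * N)
  have h5 : ((N - q : ℕ) : ℝ) ≤ 2 * N := by exact_mod_cast (by omega : N - q ≤ 2 * N)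
  have h6 : sparseCoeff m α * ‖fejerKernel m q x‖ ≤
      2 * N * (‖u - g x‖ + ‖v - g x‖ + ‖w - g x‖) := by
    have := mul_le_mul_of_nonneg_right h4 (norm_nonneg (u - g x))
    have := mul_le_mul_of_nonneg_right h5 (norm_nonneg (w - g x))
    linarith
  have h7 : (1 / (2 * (α : ℝ))) ^ 2 * ‖fejerKernel m q x‖ * (2 * N) ≤
      sparseCoeff m α * ‖fejerKernel m q x‖ := by
    rw [hc, show (1 / (2 * (α : ℝ))) ^ 2 * ‖fejerKernel m q x‖ * (2 * N) =
      1 / 2 * (N / (α : ℝ) ^ 2 * ‖fejerKernel m q x‖) by field_simp]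
    have : 0 ≤ N / (α : ℝ) ^ 2 * ‖fejerKernel m q x‖ := by positivity
    linarith
  have h8 := h7.trans h6
  rw [mul_comm (2 * (N : ℝ))] at h8
  exact le_of_mul_le_mul_right h8 (by positivity)

theorem le_eLpNorm_fejer_sparse (hm : ∀ k, 2 ≤ m k) {B : ℕ} (hB : ∀ k, m k ≤ B)
    {g : Group m → ℂ} (hg : Measurable g) (k : ℕ) :
    ENNReal.ofReal (1 / (48 * B)) ≤
      eLpNorm (fun x => fejer m (seriesMartingale m (blockCoeff m (sparseCoeff m)))
          (M m (3 * 2 ^ k) + sparseIndex m (2 ^ k)) x - g x) (ENNReal.ofReal (1 / 2)) (haar m)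
          ^ (1 / 2 : ℝ) +
        eLpNorm (fun x => fejer m (seriesMartingale m (blockCoeff m (sparseCoeff m)))
          (M m (3 * 2 ^ k)) x - g x) (ENNReal.ofReal (1 / 2)) (haar m) ^ (1 / 2 : ℝ) +
        eLpNorm (fun x => fejer m (seriesMartingale m (blockCoeff m (sparseCoeff m)))
          (M m (3 * 2 ^ k) - sparseIndex m (2 ^ k)) x - g x) (ENNReal.ofReal (1 / 2)) (haar m)
          ^ (1 / 2 : ℝ) := by
  have hhalf : (0 : ℝ) < 1 / 2 := by norm_num
  -- The root of the `L_{1/2}` quasi-norm is the integral of a square root, hence subadditive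
  -- without constants.
  have hpow : ∀ h : Group m → ℂ, eLpNorm h (ENNReal.ofReal (1 / 2)) (haar m) ^ (1 / 2 : ℝ) =
      ∫⁻ x, ‖h x‖ₑ ^ (1 / 2 : ℝ) ∂(haar m) := fun h => by
    rw [eLpNorm_ofReal hhalf, ← ENNReal.rpow_mul]
    norm_num
  simp only [hpow]
  set f := seriesMartingale m (blockCoeff m (sparseCoeff m)) with hf
  have hmeas : ∀ n, Measurable fun x => ‖fejer m f n x - g x‖ₑ ^ (1 / 2 : ℝ) := fun n =>
    (((measurable_fejer hm f n).sub hg).enorm).pow_const _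
  have hα : (0 : ℝ) < (3 * 2 ^ k : ℕ) := Nat.cast_pos.2 (by positivity)
  have hB0 : (0 : ℝ) < B := Nat.cast_pos.2 ((NeZero.pos _).trans_le (hB 0))
  rw [← lintegral_add_left (hmeas _), ← lintegral_add_right _ (hmeas _)]
  -- The growth `2^k` of the kernel integral cancels the `2^k` in `α`, and `2 · 3 · 8 = 48` remains.
  calc ENNReal.ofReal (1 / (48 * B))
      = ENNReal.ofReal (1 / (2 * (3 * 2 ^ k : ℕ))) *
          ENNReal.ofReal ((2 ^ k : ℕ) / (8 * B)) := by
        rw [← ENNReal.ofReal_mul (by positivity)]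
        congr 1
        push_cast
        field_simp
        norm_num
    _ ≤ ENNReal.ofReal (1 / (2 * (3 * 2 ^ k : ℕ))) *
          ∫⁻ x, ‖fejerKernel m (sparseIndex m (2 ^ k)) x‖ₑ ^ (1 / 2 : ℝ) ∂(haar m) :=
        mul_le_mul_right (le_lintegral_fejerKernel_sparseIndex hm hB _) _
    _ = ∫⁻ x, ENNReal.ofReal (1 / (2 * (3 * 2 ^ k : ℕ))) *
          ‖fejerKernel m (sparseIndex m (2 ^ k)) x‖ₑ ^ (1 / 2 : ℝ) ∂(haar m) :=
        (lintegral_const_mul _ ((measurable_fejerKernel hm _).enorm.pow_const _)).symm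
    _ ≤ _ := by
        refine lintegral_mono fun x => ?_
        have h := ENNReal.ofReal_le_ofReal (norm_fejerKernel_le_fejer_sparse hm k g x)
        rw [← hf, ENNReal.ofReal_mul (by positivity), ENNReal.ofReal_add (by positivity)
          (by positivity), ENNReal.ofReal_add (by positivity) (by positivity)] at h
        simp only [ofReal_norm] at h
        have h' := ENNReal.rpow_le_rpow h hhalf.le
        rw [ENNReal.mul_rpow_of_nonneg _ _ hhalf.le,
          ENNReal.ofReal_rpow_of_nonneg (by positivity) hhalf.le, ← Real.sqrt_eq_rpow,
          Real.sqrt_sq (by positivity)] at h'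
        refine h'.trans ((ENNReal.rpow_add_le_add_rpow _ _ hhalf.le (by norm_num)).trans ?_)
        exact add_le_add (ENNReal.rpow_add_le_add_rpow _ _ hhalf.le (by norm_num)) le_rfl

theorem not_tendsto_eLpNorm_sparse (hm : ∀ k, 2 ≤ m k) {B : ℕ} (hB : ∀ k, m k ≤ B)
    {g : Group m → ℂ} (hg : Measurable g) :
    ¬ Tendsto (fun n : ℕ => eLpNorm (fun x =>
      fejer m (seriesMartingale m (blockCoeff m (sparseCoeff m))) n x - g x)
        (ENNReal.ofReal (1 / 2)) (haar m)) atTop (𝓝 0) := by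
  intro hlim
  have hlim' := (ENNReal.continuous_rpow_const (y := (1 / 2 : ℝ))).tendsto 0 |>.comp hlim
  rw [ENNReal.zero_rpow_of_pos (by norm_num : (0 : ℝ) < 1 / 2)] at hlim'
  have hlow : ∀ k, k ≤ M m (3 * 2 ^ k) - sparseIndex m (2 ^ k) := fun k => by
    have h1 := sparseIndex_two_pow_add_le hm k
    have h2 := lt_M hm (3 * 2 ^ k - 1)
    have h3 := k.lt_two_pow_self
    omega
  have s1 : Tendsto (fun k => M m (3 * 2 ^ k) - sparseIndex m (2 ^ k)) atTop atTop :=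
    tendsto_atTop_mono hlow tendsto_id
  have s2 : Tendsto (fun k => M m (3 * 2 ^ k)) atTop atTop :=
    tendsto_atTop_mono (fun k => Nat.sub_le _ _) s1
  have s3 : Tendsto (fun k => M m (3 * 2 ^ k) + sparseIndex m (2 ^ k)) atTop atTop :=
    tendsto_atTop_mono (fun k => Nat.le_add_right _ _) s2
  have h := ((hlim'.comp s3).add (hlim'.comp s2)).add (hlim'.comp s1)
  simp only [add_zero] at h
  refine absurd (ge_of_tendsto' h fun k => le_eLpNorm_fejer_sparse hm hB hg k) (not_le.2 ?_)
  have hB0 : (0 : ℝ) < B := Nat.cast_pos.2 ((NeZero.pos _).trans_le (hB 0))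
  exact ENNReal.ofReal_pos.2 (by positivity)

theorem exists_martingale_half (hm : ∀ k, 2 ≤ m k) {B : ℕ} (hB : ∀ k, m k ≤ B) :
    ∃ f : ℕ → Group m → ℂ, MemHardy m (1 / 2) f ∧
      (∃ C : ℝ, ∀ᶠ N : ℕ in atTop,
        modulus m (1 / 2) f N ≤ ENNReal.ofReal (C * (1 / (N : ℝ) ^ 2))) ∧
      ∃ g : Group m → ℂ, IsLimitFunction m f g ∧
        ¬ Tendsto (fun n : ℕ => eLpNorm (fun x => fejer m f n x - g x)
          (ENNReal.ofReal (1 / 2)) (haar m)) atTop (𝓝 0) := by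
  have hhalf : (0 : ℝ) < 1 / 2 := by norm_num
  have hhalf1 : (1 / 2 : ℝ) ≤ 1 := by norm_num
  obtain ⟨g, hg⟩ := exists_isLimitFunction hm (sparseCoeff m)
  refine ⟨seriesMartingale m (blockCoeff m (sparseCoeff m)), ?_, ⟨4 * (B : ℝ) ^ 2, ?_⟩, g, hg,
    not_tendsto_eLpNorm_sparse hm hB hg.1⟩
  · have h := tsum_sparseCoeff_le hB (N := 0) (k₀ := 0) (Nat.zero_le _) (by simp)
    simp only [zero_add] at h
    exact memHardy_seriesMartingale hm hhalf hhalf1 (sparseCoeff m) ENNReal.ofReal_ne_top h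
  · filter_upwards [eventually_ge_atTop 1] with N hN
    -- The least such `k` is the start of the tail; there `3 · 2^k ≥ N` turns `(2B / (3 · 2^k))^2`
    -- into `4B^2 / N^2`.
    have hex : ∃ k, N ≤ 3 * 2 ^ k := ⟨N, by have := N.lt_two_pow_self; omega⟩
    classical
    have hfind := Nat.find_spec hex
    have h := modulus_seriesMartingale_le hm hhalf hhalf1 (sparseCoeff m) N
      (tsum_sparseCoeff_le hB hfind fun k hk => not_le.1 (Nat.find_min hex hk))
    refine h.trans ?_
    have hN0 : (0 : ℝ) < N := Nat.cast_pos.2 hN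
    have hN' : (N : ℝ) ≤ 3 * 2 ^ Nat.find hex := by exact_mod_cast hfind
    rw [ENNReal.ofReal_rpow_of_nonneg (by positivity) (by norm_num), one_div_one_div,
      Real.rpow_two]
    refine ENNReal.ofReal_le_ofReal ?_
    calc (2 * B / (3 * 2 ^ Nat.find hex) : ℝ) ^ 2 ≤ (2 * B / N : ℝ) ^ 2 := by gcongr
      _ = 4 * (B : ℝ) ^ 2 * (1 / (N : ℝ) ^ 2) := by ring

end Sparse

end Vilenkin

theorem theorem2 (m : ℕ → ℕ) [∀ k, NeZero (m k)] (hm : ∀ k, 2 ≤ m k)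
    (hbdd : ∃ B, ∀ k, m k ≤ B) :
    (∀ p : ℝ, 0 < p → p < 1 / 2 →
      ∃ f : ℕ → Vilenkin.Group m → ℂ, Vilenkin.MemHardy m p f ∧
        (∃ C : ℝ, ∀ᶠ N : ℕ in atTop, Vilenkin.modulus m p f N ≤
          ENNReal.ofReal (C * (1 / (Vilenkin.M m N : ℝ) ^ (1 / p - 2)))) ∧
        ∃ g : Vilenkin.Group m → ℂ, Vilenkin.IsLimitFunction m f g ∧
          ¬ Tendsto (fun n : ℕ => Vilenkin.weakNorm m p fun x => Vilenkin.fejer m f n x - g x)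
              atTop (𝓝 0)) ∧
    (∃ f : ℕ → Vilenkin.Group m → ℂ, Vilenkin.MemHardy m (1 / 2) f ∧
      (∃ C : ℝ, ∀ᶠ N : ℕ in atTop, Vilenkin.modulus m (1 / 2) f N ≤
        ENNReal.ofReal (C * (1 / (N : ℝ) ^ 2))) ∧
      ∃ g : Vilenkin.Group m → ℂ, Vilenkin.IsLimitFunction m f g ∧
        ¬ Tendsto (fun n : ℕ =>
            eLpNorm (fun x => Vilenkin.fejer m f n x - g x) (ENNReal.ofReal (1 / 2))
              (Vilenkin.haar m))
            atTop (𝓝 0)) := by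
  obtain ⟨B, hB⟩ := hbdd
  exact ⟨fun p hp hp2 => Vilenkin.exists_martingale_of_lt_half hm hB hp hp2,
    Vilenkin.exists_martingale_half hm hB⟩
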